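/- \textbf{Setting.} For an interval $\Delta\subset\mathbb R$ let $\mathcal M(\Delta)$ be the class of Borel measures of constant sign (positive or negative) whose support is infinite and contained in $\Delta$ and all of whose moments $\int x^\nu\,ds(x)$, $\nu=0,1,2,\dots$, converge absolutely. Write $\widehat s(z)=\int \frac{ds(x)}{z-x}$ for the Cauchy transform, and $d\langle\alpha,\beta\rangle(x)=\widehat\beta(x)\,d\alpha(x)$ when $\widehat\beta\in L_1(\alpha)$. Let $m\ge 2$ and let $\sigma_1,\dots,\sigma_m$ generate a Nikishin system: $\Delta_j$ is the convex hull of $\operatorname{supp}\sigma_j$ and $\sigma_j\in\mathcal M(\Delta_j)$ for $1\le j\le m$ (the $\Delta_j$ may be unbounded); for $1\le j\le m-1$ the intervals $\Delta_j,\Delta_{j+1}$ have at most one common point, and such a point is a mass point of neither $\sigma_j$ nor $\sigma_{j+1}$; and the products $\langle\sigma_j,\dots,\sigma_k\rangle=\langle\sigma_j,\langle\sigma_{j+1},\dots,\sigma_k\rangle\rangle$, $1\le j<k\le m$, are well defined, i.e. the Cauchy transform of $\langle\sigma_{j+1},\dots,\sigma_k\rangle$ belongs to $L_1(\sigma_j)$.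 For $1\le j\le k\le m$ put $s_{j,k}=\langle\sigma_j,\sigma_{j+1},\dots,\sigma_k\rangle$ and $s_{k,j}=\langle\sigma_k,\sigma_{k-1},\dots,\sigma_j\rangle$ (so $s_{j,j}=\sigma_j$). For a function $f$ the relation $f(z)=\mathcal O(1/z^k)$ relative to an interval $\Delta$ means that for each $\delta>0$ it holds as $z\to\infty$ within $\{z\in\mathbb C:\operatorname{dist}(z,\Delta)\ge\delta|z|\}$ (non-tangential approach; for bounded $\Delta$ this is the usual meaning). Let $n\ge 1$, and let $a_{n,0},\dots,a_{n,m}$ be complex polynomials, not all zero, with $\deg a_{n,j}\le n-1$ for $0\le j\le m-1$ and $\deg a_{n,m}\le n$. Put $$\mathcal A_{n,j}=(-1)^j a_{n,j}+\sum_{k=j+1}^m(-1)^k a_{n,k}\,\widehat s_{j+1,k},\qquad 0\le j\le m-1 .$$ The vector $(a_{n,0},\dots,a_{n,m})$ consists of \emph{multi-level (ML)} Hermite--Padé polynomials if $\mathcal A_{n,0}(z)=\mathcal O(1/z^{n+1})$ relative to $\Delta_1$ and $\mathcal A_{n,j}(z)=\mathcal O(1/z)$ relative to $\Delta_{j+1}$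 for $1\le j\le m-1$. It consists of \emph{direct/reversed (DR)} Hermite--Padé polynomials if $\mathcal A_{n,0}(z)=\mathcal O(1/z^{n+1})$ relative to $\Delta_1$ and $(-1)^j\bigl(a_{n,j}-a_{n,m}\widehat s_{m,j+1}\bigr)(z)=\mathcal O(1/z)$ relative to $\Delta_m$ for $1\le j\le m-1$. \textbf{Theorem.} For each $n\ge1$: (i) a vector of polynomials is a vector of DR Hermite--Padé polynomials if and only if it is a vector of ML Hermite--Padé polynomials; (ii) such a vector exists, and it is unique up to multiplication by a nonzero constant; (iii) $\deg a_{n,j}=n-1$ for $j=0,\dots,m-1$, and $\deg a_{n,m}=n$; (iv) all zeros of $a_{n,m-1}$ and of $a_{n,m}$ are simple and lie in the interior (in $\mathbb R$) of $\Delta_m$. -/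

import Mathlib

open MeasureTheory Filter Asymptotics Polynomial

noncomputable section

namespace Nikishin

/-- The support of a signed Borel measure on the line, that is, of its variation. -/
def supp (s : SignedMeasure ℝ) : Set ℝ := s.variation.support

/-- The class `𝓜(Δ)`: Borel measures of constant sign, with infinite support contained in `Δ`,
all of whose moments exist. -/
structure MemM (Δ : Set ℝ) (s : SignedMeasure ℝ) : Prop where
  constSign : 0 ≤ s ∨ s ≤ 0
  infinite_supp : (supp s).Infinite
  supp_subset : supp s ⊆ Δ
  moments : ∀ ν : ℕ, s.Integrable (fun x : ℝ => x ^ ν)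

/-- The Cauchy transform `ŝ(z) = ∫ ds(x) / (z - x)` at a complex point. -/
def cauchy (s : SignedMeasure ℝ) (z : ℂ) : ℂ := ∫ᵛ x, (z - (x : ℂ))⁻¹ ∂<•s

/-- The Cauchy transform `ŝ(t) = ∫ ds(x) / (t - x)` at a real point. -/
def cauchyReal (s : SignedMeasure ℝ) (t : ℝ) : ℝ := ∫ᵛ x, (t - x)⁻¹ ∂<•s

/-- The product `d⟨α, β⟩(x) = β̂(x) dα(x)` (meaningful when `β̂ ∈ L₁(α)`). -/
def prod (α β : SignedMeasure ℝ) : SignedMeasure ℝ :=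
  α.withDensity (cauchyReal β) (ContinuousLinearMap.lsmul ℝ ℝ).flip

/-- The consecutive product `⟨τ₀, τ₁, …, τ_d⟩ = ⟨τ₀, ⟨τ₁, …, τ_d⟩⟩`. -/
def chain : ℕ → (ℕ → SignedMeasure ℝ) → SignedMeasure ℝ
  | 0, τ => τ 0
  | d + 1, τ => prod (τ 0) (chain d fun i => τ (i + 1))

/-- `s_{j,k} = ⟨σ_j, σ_{j+1}, …, σ_k⟩` if `j ≤ k`, and
`s_{j,k} = ⟨σ_j, σ_{j-1}, …, σ_k⟩` if `k < j`. -/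
def sMeas (σ : ℕ → SignedMeasure ℝ) (j k : ℕ) : SignedMeasure ℝ :=
  if j ≤ k then chain (k - j) (fun i => σ (j + i)) else chain (j - k) (fun i => σ (j - i))

/-- `Δ_j`, the convex hull of the support of `σ_j`. -/
def hull (σ : ℕ → SignedMeasure ℝ) (j : ℕ) : Set ℝ := convexHull ℝ (supp (σ j))

/-- The measures `σ_1, …, σ_m` generate a Nikishin system (the values of `σ` at indices outside
`1, …, m` play no role). -/
structure IsNikishin (m : ℕ) (σ : ℕ → SignedMeasure ℝ) : Prop where
  mem : ∀ j, 1 ≤ j → j ≤ m → MemM (hull σ j) (σ j)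
  /-- consecutive intervals are disjoint or meet in a single point -/
  inter : ∀ j, 1 ≤ j → j + 1 ≤ m → (hull σ j ∩ hull σ (j + 1)).Subsingleton
  /-- a common point of consecutive intervals is not a mass point of the two measures -/
  noMass : ∀ j, 1 ≤ j → j + 1 ≤ m → ∀ x ∈ hull σ j ∩ hull σ (j + 1),
    σ j {x} = 0 ∧ σ (j + 1) {x} = 0
  /-- the consecutive products `⟨σ_j, …, σ_k⟩` are well defined -/
  integrable : ∀ j k, 1 ≤ j → j < k → k ≤ m →
    (σ j).Integrable (cauchyReal (sMeas σ (j + 1) k))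

/-- `f(z) = 𝒪(1/z^k)` as `z → ∞` non-tangentially to `Δ`, i.e. inside each of the regions
`{z : dist(z, Δ) ≥ δ |z|}`, `δ > 0`. For bounded `Δ` and `δ < 1` such a region is a full
neighbourhood of `∞`. -/
def IsONontangential (Δ : Set ℝ) (f : ℂ → ℂ) (k : ℕ) : Prop :=
  ∀ δ : ℝ, 0 < δ →
    f =O[Bornology.cobounded ℂ ⊓
        𝓟 {z : ℂ | δ * ‖z‖ ≤ Metric.infDist z ((fun x : ℝ => (x : ℂ)) '' Δ)}]
      fun z => 1 / z ^ k

/-- The form `𝓐_j = (-1)^j a_j + ∑_{k=j+1}^m (-1)^k a_k ŝ_{j+1,k}`. -/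
def levelForm (m : ℕ) (σ : ℕ → SignedMeasure ℝ) (a : ℕ → ℂ[X]) (j : ℕ) (z : ℂ) : ℂ :=
  (-1) ^ j * (a j).eval z +
    ∑ k ∈ Finset.Icc (j + 1) m, (-1) ^ k * (a k).eval z * cauchy (sMeas σ (j + 1) k) z

/-- The vector `(a_0, …, a_m)` is not zero, `deg a_j ≤ n - 1` for `j < m` and `deg a_m ≤ n`
(the entries of `a` at indices larger than `m` play no role). -/
structure IsAdmissible (m n : ℕ) (a : ℕ → ℂ[X]) : Prop where
  nonzero : ∃ j ≤ m, a j ≠ 0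
  degree_lt : ∀ j < m, (a j).degree < n
  degree_le : (a m).degree ≤ n

/-- `(a_0, …, a_m)` is a vector of direct/reversed Hermite–Padé polynomials. -/
structure IsDR (m : ℕ) (σ : ℕ → SignedMeasure ℝ) (n : ℕ) (a : ℕ → ℂ[X]) : Prop
    extends IsAdmissible m n a where
  direct : IsONontangential (hull σ 1) (levelForm m σ a 0) (n + 1)
  reversed : ∀ j, 1 ≤ j → j < m → IsONontangential (hull σ m)
    (fun z => (-1) ^ j * ((a j).eval z - (a m).eval z * cauchy (sMeas σ m (j + 1)) z)) 1

/-- `(a_0, …, a_m)` is a vector of multi-level Hermite–Padé polynomials. -/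
structure IsML (m : ℕ) (σ : ℕ → SignedMeasure ℝ) (n : ℕ) (a : ℕ → ℂ[X]) : Prop
    extends IsAdmissible m n a where
  first : IsONontangential (hull σ 1) (levelForm m σ a 0) (n + 1)
  level : ∀ j, 1 ≤ j → j < m → IsONontangential (hull σ (j + 1)) (levelForm m σ a j) 1

/-- All zeros of the polynomial `p` are simple, real, and lie in the interior of `Δ`
(interior in the topology of the line). -/
def ZerosSimpleInInterior (p : ℂ[X]) (Δ : Set ℝ) : Prop :=
  ∀ z : ℂ, p.IsRoot z → p.rootMultiplicity z = 1 ∧ ∃ x ∈ interior Δ, (x : ℂ) = z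

end Nikishin

end

noncomputable section

namespace Nikishin

/-! ### Signed measures of constant sign and their densities -/

open Topology

/-! Put R_k = a_k − a_m ŝ_{m,k+1}. Off the real line, the sum over j ≤ k ≤ m of (−1)^k ŝ_{m,k+1}
ŝ_{j+1,k} vanishes, with ŝ_{m,m+1} and ŝ_{j+1,j} read as 1; this is `IsNikishin.sum_reversedCauchy`
at w = z. Subtracting a_m times this identity writes 𝓐_j as (−1)^j R_j plus the terms (−1)^k R_k
ŝ_{j+1,k}, j < k < m. The system is triangular and the transforms decay along the imaginary axis, so
the 𝓐_j with j ≥ l have zero polynomial part exactly when the R_j with j ≥ l do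
(`IsNikishin.levelPoly_iff_reversed`). With l = 1 this is the equivalence of DR and ML.

A polynomial plus a Cauchy transform is O(1/z^{n+1}) exactly when the polynomial is zero and n
moments vanish (`isONontangential_iff`). So, among admissible vectors, the ML ones are those for
which all polynomial parts vanish and 𝓐_1 dσ_1 is orthogonal to degrees below n (`IsSolution`). With
l = 0 the first condition says that a_j is the polynomial part of a_m ŝ_{m,j+1}: only the n + 1
coefficients of a_m are free, against n linear conditions, hence existence.

For a solution, 𝓐_j is the Cauchy transform of 𝓐_{j+1} dσ_{j+1}. Orthogonality gives Re 𝓐_1 at least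
n zeros in the interior of Δ_1; vanishing of the transform there makes Re 𝓐_2 orthogonal to degrees
below n for dσ_2 divided by the product over these zeros, and so on (`IsOrthogonal.succ`). At the
last level 𝓐_m = ±a_m, so Re a_m has n zeros inside Δ_m. If deg a_m < n, this applied to a and i·a
forces a_m = 0, so the vector is zero: thus deg a_m = n, uniqueness follows by subtraction, and the
monic a_m is real with n simple zeros inside Δ_m. The other degrees come from the nonzero total mass
of s_{m,j+1}.

At a zero y of the monic a_m, the value of a_{m−1} is ∫ a_m(x)/(x − y) dσ_m(x). Positivity of
Gaussian quadrature weights (`integral_prod_erase_mul_pos`) gives it, up to a constant sign, the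
sign of a_m'(y), and `exists_zeros_of_interlacing` yields its n − 1 zeros. -/

instance isFiniteMeasure_variation (s : SignedMeasure ℝ) : IsFiniteMeasure s.variation := by
  rw [← SignedMeasure.totalVariation_eq_variation]; infer_instance

lemma exists_sign_of_constSign {s : SignedMeasure ℝ} (h : 0 ≤ s ∨ s ≤ 0) :
    ∃ ε : ℝ, (ε = 1 ∨ ε = -1) ∧ s = ε • s.variation.toSignedMeasure := by
  have key : ∀ t : SignedMeasure ℝ, 0 ≤ t → t = t.variation.toSignedMeasure := by
    intro t ht
    have h0 : 0 ≤[Set.univ] t := by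
      rw [VectorMeasure.restrict_le_restrict_iff _ _ MeasurableSet.univ]
      intro j hj _
      exact ht j hj
    obtain ⟨ν, hν, rfl⟩ : ∃ ν : Measure ℝ, ∃ _ : IsFiniteMeasure ν, ν.toSignedMeasure = t :=
      ⟨_, _, SignedMeasure.toMeasureOfZeroLE_toSignedMeasure t h0⟩
    simp
  rcases h with h | h
  · exact ⟨1, Or.inl rfl, by simpa using key s h⟩
  · refine ⟨-1, Or.inr rfl, ?_⟩
    have := key (-s) (by
      intro i hi
      have := h i hi
      simpa using this)
    simp only [VectorMeasure.variation_neg] at this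
    rw [← this]; simp

lemma integral_smul_toSignedMeasure {E : Type*} [NormedAddCommGroup E] [NormedSpace ℝ E]
    (μ : Measure ℝ) [IsFiniteMeasure μ] (ε : ℝ) (f : ℝ → E) :
    ∫ᵛ x, f x ∂<•(ε • μ.toSignedMeasure) = ε • ∫ x, f x ∂μ := by
  rw [VectorMeasure.integral_smul_vectorMeasure, VectorMeasure.integral_toSignedMeasure]

/-- The variation of the density measure is |g| dμ, so when g·f is not integrable both sides take
the default value 0. Needing nothing of f is what lets the Cauchy transform formulas hold at every
point, even on the support. -/
lemma integral_withDensityᵥ {E : Type*} [NormedAddCommGroup E] [NormedSpace ℝ E]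
    {μ : Measure ℝ} [IsFiniteMeasure μ] {g : ℝ → ℝ} (hg : Integrable g μ) (hgm : Measurable g)
    (f : ℝ → E) :
    ∫ᵛ x, f x ∂<•(μ.withDensityᵥ g) = ∫ x, g x • f x ∂μ := by
  have hvar := Measure.variation_withDensityᵥ hg
  by_cases hf : Integrable (fun x => g x • f x) μ
  · have e1 : Integrable (fun x => max (g x) 0 • f x) μ := by
      have := hf.indicator (hgm measurableSet_Ici : MeasurableSet (g ⁻¹' Set.Ici 0))
      refine this.congr (Eventually.of_forall fun x => ?_)
      by_cases hx : 0 ≤ g x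
      · simp [Set.indicator, hx]
      · simp [Set.indicator, hx, (not_le.1 hx).le]
    have e2 : Integrable (fun x => max (-g x) 0 • f x) μ := by
      have := (e1.sub hf)
      refine this.congr (Eventually.of_forall fun x => ?_)
      simp only [Pi.sub_apply, ← sub_smul]
      congr 1
      rcases le_total 0 (g x) with hx | hx <;> simp [hx]
    have i1 := isFiniteMeasure_withDensity_ofReal hg.2
    have i2 := isFiniteMeasure_withDensity_ofReal hg.neg.2
    have m1 : Measurable fun x => ENNReal.ofReal (g x) := hgm.ennreal_ofReal
    have m2 : Measurable fun x => ENNReal.ofReal (-g x) := hgm.neg.ennreal_ofReal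
    rw [withDensityᵥ_eq_withDensity_pos_part_sub_withDensity_neg_part hg,
      VectorMeasure.integral_sub_vectorMeasure, VectorMeasure.integral_toSignedMeasure,
      VectorMeasure.integral_toSignedMeasure,
      integral_withDensity_eq_integral_toReal_smul m1 (by simp),
      integral_withDensity_eq_integral_toReal_smul m2 (by simp)]
    · simp only [ENNReal.toReal_ofReal']
      rw [← integral_sub e1 e2]
      congr 1 with x
      rw [← sub_smul]
      congr 1
      rcases le_total 0 (g x) with hx | hx <;> simp [hx]
    · simpa [VectorMeasure.Integrable, integrable_withDensity_iff_integrable_smul' m1,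
        ENNReal.toReal_ofReal'] using e1
    · simpa [VectorMeasure.Integrable, integrable_withDensity_iff_integrable_smul' m2,
        ENNReal.toReal_ofReal'] using e2
  · rw [integral_undef hf, VectorMeasure.integral_undef]
    intro h
    apply hf
    rw [VectorMeasure.Integrable, hvar,
      integrable_withDensity_iff_integrable_smul' (by fun_prop) (by simp)] at h
    have h' : Integrable (fun x => |g x| • f x) μ := by simpa using h
    have e1 := h'.indicator (hgm measurableSet_Ici : MeasurableSet (g ⁻¹' Set.Ici 0))
    have e2 := (e1.add e1).sub h'
    refine e2.congr (Eventually.of_forall fun x => ?_)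
    by_cases hx : 0 ≤ g x
    · simp [Set.indicator, hx, abs_of_nonneg hx]
    · simp [Set.indicator, hx, abs_of_nonpos (not_le.1 hx).le]

lemma prod_eq_withDensityᵥ {σ β : SignedMeasure ℝ} {μ : Measure ℝ} [IsFiniteMeasure μ] {ε : ℝ}
    (hε : ε = 1 ∨ ε = -1) (hσ : σ = ε • μ.toSignedMeasure)
    (hi : Integrable (cauchyReal β) μ) :
    prod σ β = μ.withDensityᵥ fun x => ε * cauchyReal β x := by
  have hv : σ.variation = μ := by
    rw [hσ, VectorMeasure.variation_smul]
    rcases hε with rfl | rfl <;> simp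
  have hi' : σ.Integrable (cauchyReal β) := by rwa [VectorMeasure.Integrable, hv]
  ext s hs
  rw [prod, VectorMeasure.withDensity_apply hi', withDensityᵥ_apply (hi.const_mul ε) hs, hσ,
    VectorMeasure.restrict_smul, VectorMeasure.integral_smul_vectorMeasure,
    VectorMeasure.setIntegral_toSignedMeasure hs, integral_const_mul, smul_eq_mul]

/-- The signed measure `β` has the density `g` with respect to `μ`; the density has constant
sign and moments of all orders. -/
structure HasNiceDensity (β : SignedMeasure ℝ) (μ : Measure ℝ) (g : ℝ → ℝ) : Prop where
  meas : Measurable g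
  moments : ∀ ν : ℕ, Integrable (fun x => x ^ ν * g x) μ
  sign : ∃ η : ℝ, (η = 1 ∨ η = -1) ∧ ∀ᵐ x ∂μ, 0 < η * g x
  cauchyReal_eq : ∀ t : ℝ, cauchyReal β t = ∫ x, g x * (t - x)⁻¹ ∂μ
  cauchy_eq : ∀ z : ℂ, cauchy β z = ∫ x, (g x : ℂ) * (z - x)⁻¹ ∂μ

lemma HasNiceDensity.integrable {β : SignedMeasure ℝ} {μ : Measure ℝ} {g : ℝ → ℝ}
    (h : HasNiceDensity β μ g) : Integrable g μ := by simpa using h.moments 0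

lemma HasNiceDensity.cauchy_ofReal {β : SignedMeasure ℝ} {μ : Measure ℝ} {g : ℝ → ℝ}
    (h : HasNiceDensity β μ g) (t : ℝ) : cauchy β t = cauchyReal β t := by
  rw [h.cauchy_eq, h.cauchyReal_eq, ← integral_complex_ofReal]
  simp

lemma HasNiceDensity.measurable_cauchyReal {β : SignedMeasure ℝ} {μ : Measure ℝ}
    [IsFiniteMeasure μ] {g : ℝ → ℝ} (h : HasNiceDensity β μ g) : Measurable (cauchyReal β) := by
  have := h.meas
  have e : cauchyReal β = fun t => ∫ x, g x * (t - x)⁻¹ ∂μ := funext h.cauchyReal_eq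
  rw [e]
  refine (StronglyMeasurable.integral_prod_right'
    (f := fun p : ℝ × ℝ => g p.2 * (p.1 - p.2)⁻¹) ?_).measurable
  exact Measurable.stronglyMeasurable (by fun_prop)

/-! ### Separation of consecutive measures, and products with constant sign -/

/-- `μ` and `ν` are carried by complementary open half-lines. -/
def Separated (μ ν : Measure ℝ) : Prop :=
  ∃ c s : ℝ, (s = 1 ∨ s = -1) ∧ (∀ᵐ x ∂μ, s * (x - c) < 0) ∧ ∀ᵐ x ∂ν, 0 < s * (x - c)

lemma Separated.symm {μ ν : Measure ℝ} (h : Separated μ ν) : Separated ν μ := by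
  obtain ⟨c, s, hs, h1, h2⟩ := h
  refine ⟨c, -s, by rcases hs with rfl | rfl <;> simp, ?_, ?_⟩
  · filter_upwards [h2] with x hx
    linarith
  · filter_upwards [h1] with x hx
    linarith

lemma sub_bounds_of_sides {c s x y : ℝ} (hs : s = 1 ∨ s = -1) (hx : s * (x - c) < 0)
    (hy : 0 < s * (y - c)) : 0 < -s * (x - y) ∧ |x - c| ≤ |x - y| ∧ 0 < |x - c| := by
  rcases hs with rfl | rfl
  · have h1 : x - c < 0 := by linarith
    have h2 : x - y < 0 := by linarith
    rw [abs_of_neg h1, abs_of_neg h2]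
    refine ⟨?_, ?_, ?_⟩ <;> linarith
  · have h1 : 0 < x - c := by linarith
    have h2 : 0 < x - y := by linarith
    rw [abs_of_pos h1, abs_of_pos h2]
    refine ⟨?_, ?_, ?_⟩ <;> linarith

/-- The complex point `z` has positive distance from a carrier of `μ`. -/
def Away (μ : Measure ℝ) (z : ℂ) : Prop := ∃ δ : ℝ, 0 < δ ∧ ∀ᵐ x : ℝ ∂μ, δ ≤ ‖z - (x : ℂ)‖

lemma away_of_im_ne_zero (μ : Measure ℝ) {z : ℂ} (hz : z.im ≠ 0) : Away μ z :=
  ⟨|z.im|, abs_pos.2 hz, Eventually.of_forall fun x => by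
    have := Complex.abs_im_le_norm (z - (x : ℂ))
    simpa only [Complex.sub_im, Complex.ofReal_im, sub_zero] using this⟩

lemma away_of_side {μ : Measure ℝ} {c s x : ℝ} (hs : s = 1 ∨ s = -1)
    (h : ∀ᵐ y ∂μ, 0 < s * (y - c)) (hx : s * (x - c) < 0) : Away μ (x : ℂ) := by
  by_cases h0 : |x - c| = 0
  · rw [abs_eq_zero] at h0
    simp [h0] at hx
  refine ⟨|x - c|, by positivity, ?_⟩
  filter_upwards [h] with y hy
  rw [← Complex.ofReal_sub, Complex.norm_real]
  exact (sub_bounds_of_sides hs hx hy).2.1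

/-- The distance depends on x and may tend to 0 near the separating point, so touching intervals are
allowed. -/
lemma Separated.away {μ ν : Measure ℝ} (h : Separated μ ν) : ∀ᵐ x : ℝ ∂μ, Away ν (x : ℂ) := by
  obtain ⟨c, s, hs, h1, h2⟩ := h
  filter_upwards [h1] with x hx
  exact away_of_side hs h2 hx

lemma Away.integrable_mul_inv {μ : Measure ℝ} {z : ℂ} (hz : Away μ z) {G : ℝ → ℂ}
    (hG : Integrable G μ) : Integrable (fun x => G x * (z - (x : ℂ))⁻¹) μ := by
  obtain ⟨δ, hδ, h⟩ := hz
  refine hG.mul_bdd (c := δ⁻¹) ?_ ?_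
  · exact (Measurable.aestronglyMeasurable (by fun_prop))
  · filter_upwards [h] with x hx
    rw [norm_inv]
    exact inv_anti₀ hδ hx

lemma Away.integrable_mul_inv_real {μ : Measure ℝ} {t : ℝ} (ht : Away μ (t : ℂ)) {g : ℝ → ℝ}
    (hg : Integrable g μ) : Integrable (fun x => g x * (t - x)⁻¹) μ := by
  have := ht.integrable_mul_inv hg.ofReal
  simpa [← Complex.ofReal_sub, ← Complex.ofReal_inv, ← Complex.ofReal_mul] using this.re

/-- The kernel 1/(x − y) has one sign when x and y lie on opposite sides of the separating point.
There is no cancellation, so the absolute value passes under the integral, and integrability of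
products becomes a question about iterated integrals of positive kernels. -/
lemma cauchyReal_sign_step {β : SignedMeasure ℝ} {μ ν : Measure ℝ} {g : ℝ → ℝ}
    (h : HasNiceDensity β μ g) (hsep : Separated ν μ) (hμ : μ ≠ 0) :
    ∃ η : ℝ, (η = 1 ∨ η = -1) ∧ ∀ᵐ x ∂ν, 0 < η * cauchyReal β x ∧
      ‖cauchyReal β x‖ₑ = ∫⁻ y, ‖x - y‖ₑ⁻¹ * ‖g y‖ₑ ∂μ := by
  obtain ⟨η, hη, hpos⟩ := h.sign
  have haw := hsep.away
  obtain ⟨c, s, hs, h1, h2⟩ := hsep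
  refine ⟨-s * η, by rcases hs with rfl | rfl <;> rcases hη with rfl | rfl <;> simp, ?_⟩
  filter_upwards [h1, haw] with x hx hax
  have hint := hax.integrable_mul_inv_real h.integrable
  have hpt : ∀ᵐ y ∂μ, 0 < -s * η * (g y * (x - y)⁻¹) := by
    filter_upwards [hpos, h2] with y hy hy2
    have := (sub_bounds_of_sides hs hx hy2).1
    have h3 : 0 < -s * (x - y)⁻¹ := by
      rcases hs with rfl | rfl
      · have : x - y < 0 := by linarith
        have := inv_lt_zero.2 this
        linarith
      · have : 0 < x - y := by linarith
        have := inv_pos.2 this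
        linarith
    calc 0 < (-s * (x - y)⁻¹) * (η * g y) := mul_pos h3 hy
      _ = _ := by ring
  have hsη : |(-s * η)| = 1 := by
    rcases hs with rfl | rfl <;> rcases hη with rfl | rfl <;> simp
  have habs : ∀ a : ℝ, 0 ≤ -s * η * a → |a| = -s * η * a := by
    intro a ha
    rw [← abs_of_nonneg ha, abs_mul, hsη, one_mul]
  have hval : -s * η * cauchyReal β x = ∫ y, -s * η * (g y * (x - y)⁻¹) ∂μ := by
    rw [h.cauchyReal_eq, integral_const_mul]
  have hpos' : 0 < -s * η * cauchyReal β x := by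
    rw [hval, integral_pos_iff_support_of_nonneg_ae (hpt.mono fun y hy => hy.le)
      (hint.const_mul _)]
    rw [pos_iff_ne_zero]
    intro h0
    apply hμ
    rw [← Measure.measure_univ_eq_zero, ← le_zero_iff, ← h0]
    refine measure_mono_ae ?_
    filter_upwards [hpt] with y hy _
    exact hy.ne'
  refine ⟨hpos', ?_⟩
  rw [← enorm_norm, Real.norm_eq_abs, habs _ hpos'.le, hval,
    Real.enorm_of_nonneg (by rw [← hval]; exact hpos'.le),
    ofReal_integral_eq_lintegral_ofReal (hint.const_mul _) (hpt.mono fun y hy => hy.le)]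
  refine lintegral_congr_ae ?_
  filter_upwards [hpt, h2] with y hy hy2
  have h3 := (sub_bounds_of_sides hs hx hy2).1
  have hxy : x - y ≠ 0 := by intro h0; simp [h0] at h3
  rw [← habs _ hy.le, ← Real.norm_eq_abs, ofReal_norm, enorm_mul, enorm_inv hxy, mul_comm]

/-- Split at distance 1 from the separating point c. Nearby, x^k is bounded and the transform is
integrable by assumption; farther away |x − y| ≥ 1, so the transform is bounded by the total mass
and the moments of ν suffice. -/
lemma integrable_pow_mul_cauchyReal {β : SignedMeasure ℝ} {μ ν : Measure ℝ} {g : ℝ → ℝ}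
    [IsFiniteMeasure μ]
    (h : HasNiceDensity β μ g) (hsep : Separated ν μ)
    (hν : ∀ k : ℕ, Integrable (fun x : ℝ => x ^ k) ν) (hi : Integrable (cauchyReal β) ν) (k : ℕ) :
    Integrable (fun x => x ^ k * cauchyReal β x) ν := by
  obtain ⟨c, s, hs, h1, h2⟩ := hsep
  set C : ℝ := ∫ y, |g y| ∂μ with hC
  have hC0 : 0 ≤ C := integral_nonneg fun y => abs_nonneg _
  have hdom : Integrable (fun x => (|c| + 1) ^ k * |cauchyReal β x| + C * |x ^ k|) ν :=
    (hi.abs.const_mul _).add ((hν k).abs.const_mul _)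
  refine hdom.mono' ((by fun_prop : Measurable fun x : ℝ => x ^ k).mul
    h.measurable_cauchyReal).aestronglyMeasurable ?_
  filter_upwards [h1] with x hx
  rw [norm_mul, Real.norm_eq_abs, Real.norm_eq_abs]
  by_cases hxc : |x - c| < 1
  · have : |x ^ k| ≤ (|c| + 1) ^ k := by
      rw [abs_pow]
      have : |x| ≤ |c| + 1 := by
        have := abs_sub_abs_le_abs_sub x c
        linarith
      gcongr
    have h3 : 0 ≤ C * |x ^ k| := by positivity
    have := mul_le_mul_of_nonneg_right this (abs_nonneg (cauchyReal β x))
    linarith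
  · have : |cauchyReal β x| ≤ C := by
      rw [h.cauchyReal_eq, hC]
      refine (abs_integral_le_integral_abs).trans ?_
      refine integral_mono_of_nonneg (Eventually.of_forall fun y => abs_nonneg _)
        h.integrable.abs ?_
      filter_upwards [h2] with y hy
      have h3 := (sub_bounds_of_sides hs hx hy).2.1
      simp only [abs_mul, abs_inv]
      have : |x - y|⁻¹ ≤ 1 := inv_le_one_of_one_le₀ (by linarith)
      exact mul_le_of_le_one_right (abs_nonneg _) this
    have h3 : 0 ≤ (|c| + 1) ^ k * |cauchyReal β x| := by positivity
    have := mul_le_mul_of_nonneg_left this (abs_nonneg (x ^ k))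
    linarith

lemma hasNiceDensity_single {σ : SignedMeasure ℝ} {μ : Measure ℝ} [IsFiniteMeasure μ] {ε : ℝ}
    (hε : ε = 1 ∨ ε = -1) (hσ : σ = ε • μ.toSignedMeasure)
    (hμ : ∀ k : ℕ, Integrable (fun x : ℝ => x ^ k) μ) :
    HasNiceDensity σ μ fun _ => ε where
  meas := measurable_const
  moments ν := (hμ ν).mul_const ε
  sign := ⟨ε, hε, Eventually.of_forall fun x => by rcases hε with rfl | rfl <;> simp⟩
  cauchyReal_eq t := by
    rw [cauchyReal, hσ, integral_smul_toSignedMeasure, integral_const_mul, smul_eq_mul]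
  cauchy_eq z := by
    rw [cauchy, hσ, integral_smul_toSignedMeasure, integral_const_mul, Complex.real_smul]

lemma HasNiceDensity.prod {σ β : SignedMeasure ℝ} {μ ν : Measure ℝ} [IsFiniteMeasure μ]
    [IsFiniteMeasure ν] {g : ℝ → ℝ} {ε : ℝ} (h : HasNiceDensity β μ g)
    (hε : ε = 1 ∨ ε = -1) (hσ : σ = ε • ν.toSignedMeasure) (hsep : Separated ν μ) (hμ : μ ≠ 0)
    (hν : ∀ k : ℕ, Integrable (fun x : ℝ => x ^ k) ν) (hi : Integrable (cauchyReal β) ν) :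
    HasNiceDensity (prod σ β) ν fun x => ε * cauchyReal β x where
  meas := h.measurable_cauchyReal.const_mul ε
  moments k := by
    refine ((integrable_pow_mul_cauchyReal h hsep hν hi k).const_mul ε).congr
      (Eventually.of_forall fun x => ?_)
    ring
  sign := by
    obtain ⟨η, hη, hpos⟩ := cauchyReal_sign_step h hsep hμ
    refine ⟨η * ε, by rcases hε with rfl | rfl <;> rcases hη with rfl | rfl <;> simp, ?_⟩
    filter_upwards [hpos] with x hx
    have : ε * ε = 1 := by rcases hε with rfl | rfl <;> simp
    calc 0 < η * cauchyReal β x := hx.1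
      _ = η * cauchyReal β x * (ε * ε) := by rw [this, mul_one]
      _ = _ := by ring
  cauchyReal_eq t := by
    rw [cauchyReal, prod_eq_withDensityᵥ hε hσ hi,
      integral_withDensityᵥ (hi.const_mul ε) (h.measurable_cauchyReal.const_mul ε)]
    simp only [smul_eq_mul]
  cauchy_eq z := by
    rw [cauchy, prod_eq_withDensityᵥ hε hσ hi,
      integral_withDensityᵥ (hi.const_mul ε) (h.measurable_cauchyReal.const_mul ε)]
    simp only [Complex.real_smul]

lemma separated_of_le {μ ν : Measure ℝ} (hμ : μ.support.Nonempty) (hν : ν.support.Nonempty)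
    (hle : ∀ a ∈ μ.support, ∀ b ∈ ν.support, a ≤ b)
    (hm : ∀ x ∈ μ.support ∩ ν.support, μ {x} = 0 ∧ ν {x} = 0) : Separated μ ν := by
  have hb1 : BddAbove μ.support := by
    obtain ⟨b, hb⟩ := hν
    exact ⟨b, fun a ha => hle a ha b hb⟩
  have hb2 : BddBelow ν.support := by
    obtain ⟨a, ha⟩ := hμ
    exact ⟨a, fun b hb => hle a ha b hb⟩
  have h1 := Measure.isClosed_support.csSup_mem hμ hb1
  have h2 := Measure.isClosed_support.csInf_mem hν hb2
  have ae1 : ∀ᵐ x ∂μ, x ∈ μ.support := Measure.support_mem_ae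
  have ae2 : ∀ᵐ x ∂ν, x ∈ ν.support := Measure.support_mem_ae
  rcases (hle _ h1 _ h2).lt_or_eq with hlt | heq
  -- With a gap, cut in the middle. Without one, cut at the common point, which is null for both
  -- measures.
  · refine ⟨(sSup μ.support + sInf ν.support) / 2, 1, Or.inl rfl, ?_, ?_⟩
    · filter_upwards [ae1] with x hx
      have := le_csSup hb1 hx
      linarith
    · filter_upwards [ae2] with x hx
      have := csInf_le hb2 hx
      linarith
  · obtain ⟨m1, m2⟩ := hm (sSup μ.support) ⟨h1, by rw [heq]; exact h2⟩
    refine ⟨sSup μ.support, 1, Or.inl rfl, ?_, ?_⟩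
    · have : ∀ᵐ x ∂μ, x ≠ sSup μ.support := by
        rw [ae_iff]; simpa using m1
      filter_upwards [ae1, this] with x hx hne
      have := lt_of_le_of_ne (le_csSup hb1 hx) hne
      linarith
    · have : ∀ᵐ x ∂ν, x ≠ sSup μ.support := by
        rw [ae_iff]; simpa using m2
      filter_upwards [ae2, this] with x hx hne
      have := lt_of_le_of_ne (csInf_le hb2 hx) (by rw [← heq]; exact hne.symm)
      rw [← heq] at this
      linarith

lemma Ioo_subset_interior_convexHull {S : Set ℝ} {x y : ℝ} (hx : x ∈ S) (hy : y ∈ S) :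
    Set.Ioo x y ⊆ interior (convexHull ℝ S) := by
  refine interior_maximal ?_ isOpen_Ioo
  intro t ht
  exact (convex_convexHull ℝ S).ordConnected.out (subset_convexHull ℝ S hx)
    (subset_convexHull ℝ S hy) ⟨ht.1.le, ht.2.le⟩

lemma nonempty_interior_convexHull {S : Set ℝ} (hS : S.Infinite) :
    (interior (convexHull ℝ S)).Nonempty := by
  obtain ⟨x, hx, y, hy, hxy⟩ := hS.nontrivial
  rcases lt_or_gt_of_ne hxy with h | h
  · obtain ⟨t, ht⟩ := exists_between h
    exact ⟨t, Ioo_subset_interior_convexHull hx hy ht⟩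
  · obtain ⟨t, ht⟩ := exists_between h
    exact ⟨t, Ioo_subset_interior_convexHull hy hx ht⟩

lemma infinite_inter_interior_convexHull {S : Set ℝ} (hS : S.Infinite) :
    (S ∩ interior (convexHull ℝ S)).Infinite := by
  have h1 : {x ∈ S | ∀ y ∈ S, x ≤ y}.Subsingleton := fun x hx y hy =>
    le_antisymm (hx.2 y hy.1) (hy.2 x hx.1)
  have h2 : {x ∈ S | ∀ y ∈ S, y ≤ x}.Subsingleton := fun x hx y hy =>
    le_antisymm (hy.2 x hx.1) (hx.2 y hy.1)
  refine (hS.sdiff (h1.finite.union h2.finite)).mono ?_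
  rintro x ⟨hx, hn⟩
  refine ⟨hx, ?_⟩
  simp only [Set.mem_union, Set.mem_ofPred_eq, not_or, not_and, not_forall, not_le] at hn
  obtain ⟨a, ha, hax⟩ := hn.1 hx
  obtain ⟨b, hb, hxb⟩ := hn.2 hx
  exact Ioo_subset_interior_convexHull ha hb ⟨hax, hxb⟩

lemma subset_closure_interior_convexHull {S : Set ℝ} (hS : S.Infinite) :
    S ⊆ closure (interior (convexHull ℝ S)) := by
  rw [(convex_convexHull ℝ S).closure_interior_eq_closure_of_nonempty_interior
    (nonempty_interior_convexHull hS)]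
  exact (subset_convexHull ℝ S).trans subset_closure

/-- The interiors of the two hulls meet in an open set with at most one point, hence not at all, so
one interval precedes the other. The order passes to closures, and an infinite support lies in the
closure of the interior of its hull. -/
lemma separated_of_convexHull {μ ν : Measure ℝ} (hμ : μ.support.Infinite)
    (hν : ν.support.Infinite)
    (hs : (convexHull ℝ μ.support ∩ convexHull ℝ ν.support).Subsingleton)
    (hm : ∀ x ∈ convexHull ℝ μ.support ∩ convexHull ℝ ν.support, μ {x} = 0 ∧ ν {x} = 0) :
    Separated μ ν := by
  set A := interior (convexHull ℝ μ.support) with hA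
  set B := interior (convexHull ℝ ν.support) with hB
  have hAB : A ∩ B = ∅ := by
    by_contra hne
    obtain ⟨x, hx⟩ := Set.nonempty_iff_ne_empty.2 hne
    have ho : IsOpen (A ∩ B) := isOpen_interior.inter isOpen_interior
    have hss : (A ∩ B).Subsingleton :=
      hs.anti (Set.inter_subset_inter interior_subset interior_subset)
    rw [hss.eq_singleton_of_mem hx] at ho
    exact not_isOpen_singleton x ho
  have hAo : A.OrdConnected := (convex_convexHull ℝ μ.support).interior.ordConnected
  have hBo : B.OrdConnected := (convex_convexHull ℝ ν.support).interior.ordConnected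
  -- Intervals that occur in both orders overlap: the larger of the two left ends lies in both.
  have hcross : ∀ a ∈ A, ∀ b ∈ B, ∀ a' ∈ A, ∀ b' ∈ B, a < b → b' < a' → False := by
    intro a ha b hb a' ha' b' hb' hab hba
    have : max (min a a') (min b b') ∈ A ∩ B := by
      constructor
      · refine hAo.uIcc_subset ha ha' ⟨le_max_left _ _, ?_⟩
        exact max_le min_le_max ((min_le_right _ _).trans (hba.le.trans (le_max_right _ _)))
      · refine hBo.uIcc_subset hb hb' ⟨le_max_right _ _, ?_⟩
        exact max_le ((min_le_left _ _).trans (hab.le.trans (le_max_left _ _))) min_le_max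
    rw [hAB] at this
    exact this
  have hne : ∀ a ∈ A, ∀ b ∈ B, a ≠ b := by
    rintro a ha b hb rfl
    have : a ∈ A ∩ B := ⟨ha, hb⟩
    rw [hAB] at this
    exact this
  obtain ⟨a, ha⟩ := nonempty_interior_convexHull hμ
  obtain ⟨b, hb⟩ := nonempty_interior_convexHull hν
  have hclos : ∀ {S T : Set ℝ}, (∀ x ∈ S, ∀ y ∈ T, x ≤ y) →
      ∀ x ∈ closure S, ∀ y ∈ closure T, x ≤ y := by
    intro S T h x hx y hy
    have h1 : ∀ y ∈ T, x ≤ y := fun y hy =>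
      closure_minimal (fun x hx => h x hx y hy) isClosed_Iic hx
    exact closure_minimal (fun y hy => h1 y hy) isClosed_Ici hy
  have hsubA := subset_closure_interior_convexHull hμ
  have hsubB := subset_closure_interior_convexHull hν
  have iA := subset_convexHull ℝ μ.support
  have iB := subset_convexHull ℝ ν.support
  rcases lt_or_gt_of_ne (hne a ha b hb) with h | h
  · have hle : ∀ x ∈ A, ∀ y ∈ B, x ≤ y := fun x hx y hy =>
      not_lt.1 fun hlt => hcross a ha b hb x hx y hy h hlt
    exact separated_of_le hμ.nonempty hν.nonempty
      (fun x hx y hy => hclos hle x (hsubA hx) y (hsubB hy)) fun x hx => hm x ⟨iA hx.1, iB hx.2⟩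
  · have hle : ∀ y ∈ B, ∀ x ∈ A, y ≤ x := fun y hy x hx =>
      not_lt.1 fun hlt => hcross x hx y hy a ha b hb hlt h
    exact (separated_of_le hν.nonempty hμ.nonempty
      (fun y hy x hx => hclos hle y (hsubB hy) x (hsubA hx))
      fun x hx => (hm x ⟨iA hx.2, iB hx.1⟩).symm).symm

/-- The sign of a signed measure of constant sign. -/
def sgn (s : SignedMeasure ℝ) : ℝ :=
  Classical.epsilon fun ε => (ε = 1 ∨ ε = -1) ∧ s = ε • s.variation.toSignedMeasure

lemma sgn_spec {s : SignedMeasure ℝ} (h : 0 ≤ s ∨ s ≤ 0) :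
    (sgn s = 1 ∨ sgn s = -1) ∧ s = sgn s • s.variation.toSignedMeasure :=
  Classical.epsilon_spec (exists_sign_of_constSign h)

lemma variation_singleton_eq_zero {s : SignedMeasure ℝ} (h : 0 ≤ s ∨ s ≤ 0) {x : ℝ}
    (hx : s {x} = 0) : s.variation {x} = 0 := by
  obtain ⟨hε, hs⟩ := sgn_spec h
  rw [hs] at hx
  have h0 : sgn s ≠ 0 := by rcases hε with h | h <;> rw [h] <;> norm_num
  simpa [h0, Measure.toSignedMeasure_apply_measurable, measureReal_def,
    ENNReal.toReal_eq_zero_iff] using hx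

/-! ### Densities of the forward and backward products -/

section System

variable {m : ℕ} {σ : ℕ → SignedMeasure ℝ}

lemma IsNikishin.sgn_spec (h : IsNikishin m σ) {j : ℕ} (h1 : 1 ≤ j) (h2 : j ≤ m) :
    (sgn (σ j) = 1 ∨ sgn (σ j) = -1) ∧ σ j = sgn (σ j) • (σ j).variation.toSignedMeasure :=
  Nikishin.sgn_spec (h.mem j h1 h2).constSign

lemma IsNikishin.moments (h : IsNikishin m σ) {j : ℕ} (h1 : 1 ≤ j) (h2 : j ≤ m) (k : ℕ) :
    Integrable (fun x : ℝ => x ^ k) (σ j).variation := (h.mem j h1 h2).moments k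

lemma IsNikishin.separated (h : IsNikishin m σ) {j : ℕ} (h1 : 1 ≤ j) (h2 : j + 1 ≤ m) :
    Separated (σ j).variation (σ (j + 1)).variation := by
  have m1 := h.mem j h1 (by omega)
  have m2 := h.mem (j + 1) (by omega) h2
  refine separated_of_convexHull m1.infinite_supp m2.infinite_supp (h.inter j h1 h2) ?_
  intro x hx
  obtain ⟨e1, e2⟩ := h.noMass j h1 h2 x hx
  exact ⟨variation_singleton_eq_zero m1.constSign e1,
    variation_singleton_eq_zero m2.constSign e2⟩

lemma IsNikishin.variation_ne_zero (h : IsNikishin m σ) {j : ℕ} (h1 : 1 ≤ j) (h2 : j ≤ m) :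
    (σ j).variation ≠ 0 := by
  intro h0
  have := (h.mem j h1 h2).infinite_supp
  rw [supp, h0] at this
  simp at this

lemma sMeas_self (σ : ℕ → SignedMeasure ℝ) (j : ℕ) : sMeas σ j j = σ j := by
  simp [sMeas, chain]

lemma sMeas_forward (σ : ℕ → SignedMeasure ℝ) {j k : ℕ} (h : j < k) :
    sMeas σ j k = prod (σ j) (sMeas σ (j + 1) k) := by
  obtain ⟨d, rfl⟩ : ∃ d, k = j + 1 + d := ⟨k - (j + 1), by omega⟩
  have e1 : j + 1 + d - j = d + 1 := by omega
  have e2 : j + 1 + d - (j + 1) = d := by omega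
  rw [sMeas, sMeas, if_pos (by omega), if_pos (by omega), e1, e2, chain]
  simp only [add_zero, add_assoc, add_comm 1]

lemma sMeas_backward (σ : ℕ → SignedMeasure ℝ) {j k : ℕ} (h : k < j) :
    sMeas σ j k = prod (σ j) (sMeas σ (j - 1) k) := by
  obtain ⟨d, rfl⟩ : ∃ d, j = k + d + 1 := ⟨j - (k + 1), by omega⟩
  rw [show k + d + 1 - 1 = k + d by omega]
  rcases Nat.eq_zero_or_pos d with rfl | hd
  · simp [sMeas, chain]
  · have e1 : k + d + 1 - k = d + 1 := by omega
    have e2 : k + d - k = d := by omega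
    rw [sMeas, sMeas, if_neg (by omega), if_neg (by omega), e1, e2, chain]
    simp only [Nat.sub_zero]
    congr 2
    ext1 i
    congr 1
    omega

/-- The density of `s_{j,k}` with respect to the variation of `σ_j`. -/
def dens (σ : ℕ → SignedMeasure ℝ) (j k : ℕ) (x : ℝ) : ℝ :=
  sgn (σ j) * if j = k then 1 else if j < k then cauchyReal (sMeas σ (j + 1) k) x
    else cauchyReal (sMeas σ (j - 1) k) x

/-- The iterated integral of `∏ |x_i - x_{i+1}|⁻¹` over `x_{j}, …, x_{j+d-1}`, starting at `x`. -/
def absForward (μ : ℕ → Measure ℝ) : ℕ → ℕ → ℝ → ENNReal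
  | 0, _, _ => 1
  | d + 1, j, x => ∫⁻ y, ‖x - y‖ₑ⁻¹ * absForward μ d (j + 1) y ∂(μ j)

/-- The iterated integral of `∏ |x_i - x_{i+1}|⁻¹` over `x_{j+d-1}, …, x_j`, starting at `x`. -/
def absBackward (μ : ℕ → Measure ℝ) : ℕ → ℕ → ℝ → ENNReal
  | 0, _, _ => 1
  | d + 1, j, x => ∫⁻ y, ‖x - y‖ₑ⁻¹ * absBackward μ d j y ∂(μ (j + d))

lemma measurable_absForward (μ : ℕ → Measure ℝ) [∀ j, IsFiniteMeasure (μ j)] (d j : ℕ) :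
    Measurable (absForward μ d j) := by
  induction d generalizing j with
  | zero => exact measurable_const
  | succ d ih =>
    have := ih (j + 1)
    exact Measurable.lintegral_prod_right' (f := fun p : ℝ × ℝ =>
      ‖p.1 - p.2‖ₑ⁻¹ * absForward μ d (j + 1) p.2) (by fun_prop)

lemma measurable_absBackward (μ : ℕ → Measure ℝ) [∀ j, IsFiniteMeasure (μ j)] (d j : ℕ) :
    Measurable (absBackward μ d j) := by
  induction d generalizing j with
  | zero => exact measurable_const
  | succ d ih =>
    have := ih j
    exact Measurable.lintegral_prod_right' (f := fun p : ℝ × ℝ =>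
      ‖p.1 - p.2‖ₑ⁻¹ * absBackward μ d j p.2) (by fun_prop)

lemma lintegral_absBackward_mul_absForward_step (μ : ℕ → Measure ℝ)
    [∀ j, IsFiniteMeasure (μ j)] (i e j : ℕ) :
    ∫⁻ x, absBackward μ i j x * absForward μ (e + 1) (j + i + 1) x ∂(μ (j + i)) =
      ∫⁻ x, absBackward μ (i + 1) j x * absForward μ e (j + i + 2) x ∂(μ (j + i + 1)) := by
  have m1 := measurable_absBackward μ i j
  have m2 := measurable_absForward μ e (j + i + 2)
  calc _ = ∫⁻ x, ∫⁻ y, absBackward μ i j x * (‖x - y‖ₑ⁻¹ * absForward μ e (j + i + 2) y)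
        ∂(μ (j + i + 1)) ∂(μ (j + i)) := by
        refine lintegral_congr fun x => ?_
        rw [absForward, lintegral_const_mul _ (by fun_prop)]
    _ = ∫⁻ y, ∫⁻ x, absBackward μ i j x * (‖x - y‖ₑ⁻¹ * absForward μ e (j + i + 2) y)
        ∂(μ (j + i)) ∂(μ (j + i + 1)) := by
        rw [lintegral_lintegral_swap (by fun_prop)]
    _ = _ := by
        refine lintegral_congr fun y => ?_
        rw [absBackward, ← lintegral_mul_const _ (by fun_prop)]
        refine lintegral_congr fun x => ?_
        rw [enorm_sub_rev]
        ring

/-- Both sides are the same positive iterated integral over x_j, …, x_{j+i+e}, with a different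
variable integrated last; Tonelli hands over one kernel at a time. -/
lemma lintegral_absBackward_mul_absForward (μ : ℕ → Measure ℝ)
    [∀ j, IsFiniteMeasure (μ j)] (i e j : ℕ) :
    ∫⁻ x, absBackward μ i j x * absForward μ e (j + i + 1) x ∂(μ (j + i)) =
      ∫⁻ x, absForward μ (i + e) (j + 1) x ∂(μ j) := by
  induction i generalizing e with
  | zero => simp [absBackward]
  | succ i ih =>
    have := lintegral_absBackward_mul_absForward_step μ i e j
    rw [ih] at this
    rw [show i + 1 + e = i + (e + 1) by ring, this]
    rfl

lemma hasNiceDensity_forward (h : IsNikishin m σ) (d : ℕ) : ∀ j, 1 ≤ j → j + d ≤ m →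
    HasNiceDensity (sMeas σ j (j + d)) (σ j).variation (dens σ j (j + d)) ∧
    ∀ᵐ x ∂(σ j).variation,
      ‖dens σ j (j + d) x‖ₑ = absForward (fun i => (σ i).variation) d (j + 1) x := by
  induction d with
  | zero =>
    intro j h1 h2
    obtain ⟨hε, hs⟩ := h.sgn_spec h1 h2
    have e : dens σ j (j + 0) = fun _ => sgn (σ j) := by ext x; simp [dens]
    rw [e, add_zero, sMeas_self]
    refine ⟨hasNiceDensity_single hε hs (h.moments h1 h2), Eventually.of_forall fun x => ?_⟩
    rcases hε with hε | hε <;> simp [hε, absForward]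
  | succ d ih =>
    intro j h1 h2
    have h3 : j ≤ m := by omega
    obtain ⟨hε, hs⟩ := h.sgn_spec h1 h3
    obtain ⟨i1, i2⟩ := ih (j + 1) (by omega) (by omega)
    have e0 : j + 1 + d = j + (d + 1) := by ring
    rw [e0] at i1 i2
    have e : dens σ j (j + (d + 1)) =
        fun x => sgn (σ j) * cauchyReal (sMeas σ (j + 1) (j + (d + 1))) x := by
      ext x; simp [dens]
    have hsep := h.separated h1 (by omega)
    have hne := h.variation_ne_zero (show 1 ≤ j + 1 by omega) (by omega)
    rw [e, sMeas_forward σ (show j < j + (d + 1) by omega)]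
    refine ⟨i1.prod hε hs hsep hne (h.moments h1 h3) (h.integrable j _ h1 (by omega) h2), ?_⟩
    obtain ⟨η, -, hη⟩ := cauchyReal_sign_step i1 hsep hne
    filter_upwards [hη] with x hx
    rw [enorm_mul, hx.2, absForward]
    rw [show ‖sgn (σ j)‖ₑ = 1 by rcases hε with hε | hε <;> simp [hε], one_mul]
    refine lintegral_congr_ae ?_
    filter_upwards [i2] with y hy
    rw [hy]

lemma lintegral_absForward_lt_top (h : IsNikishin m σ) {d j : ℕ} (h1 : 1 ≤ j) (h2 : j + d ≤ m) :
    ∫⁻ x, absForward (fun i => (σ i).variation) d (j + 1) x ∂(σ j).variation < ⊤ := by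
  obtain ⟨i1, i2⟩ := hasNiceDensity_forward h d j h1 h2
  rw [← lintegral_congr_ae i2]
  exact i1.integrable.2

/-- The definition of a Nikishin system asks only that the forward products exist. The backward ones
exist because, all kernels having constant sign, their absolute integrals equal the forward ones by
Tonelli. -/
lemma hasNiceDensity_backward (h : IsNikishin m σ) (d : ℕ) : ∀ j, 1 ≤ j → j + d ≤ m →
    HasNiceDensity (sMeas σ (j + d) j) (σ (j + d)).variation (dens σ (j + d) j) ∧
    ∀ᵐ x ∂(σ (j + d)).variation,
      ‖dens σ (j + d) j x‖ₑ = absBackward (fun i => (σ i).variation) d j x := by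
  induction d with
  | zero =>
    intro j h1 h2
    refine ⟨(hasNiceDensity_forward h 0 j h1 h2).1, Eventually.of_forall fun x => ?_⟩
    rcases (h.sgn_spec h1 h2).1 with hε | hε <;> simp [hε, absBackward, dens]
  | succ d ih =>
    intro j h1 h2
    obtain ⟨hε, hs⟩ := h.sgn_spec (show 1 ≤ j + (d + 1) by omega) h2
    obtain ⟨i1, i2⟩ := ih j h1 (by omega)
    have e : dens σ (j + (d + 1)) j =
        fun x => sgn (σ (j + (d + 1))) * cauchyReal (sMeas σ (j + d) j) x := by
      ext x
      rw [dens, if_neg (by omega), if_neg (by omega)]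
      rfl
    have hsep := (h.separated (show 1 ≤ j + d by omega) (by omega)).symm
    have hne := h.variation_ne_zero (show 1 ≤ j + d by omega) (by omega)
    obtain ⟨η, -, hη⟩ := cauchyReal_sign_step i1 hsep hne
    have hab : ∀ᵐ x ∂(σ (j + (d + 1))).variation, ‖cauchyReal (sMeas σ (j + d) j) x‖ₑ =
        absBackward (fun i => (σ i).variation) (d + 1) j x := by
      filter_upwards [hη] with x hx
      rw [hx.2, absBackward]
      refine lintegral_congr_ae ?_
      filter_upwards [i2] with y hy
      rw [hy]
    have hint : Integrable (cauchyReal (sMeas σ (j + d) j)) (σ (j + (d + 1))).variation := by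
      refine ⟨i1.measurable_cauchyReal.aestronglyMeasurable, ?_⟩
      rw [HasFiniteIntegral, lintegral_congr_ae hab]
      have := lintegral_absBackward_mul_absForward (fun i => (σ i).variation) (d + 1) 0 j
      simp only [absForward, mul_one] at this
      rw [this]
      exact lintegral_absForward_lt_top h h1 h2
    rw [e, sMeas_backward σ (show j < j + (d + 1) by omega)]
    refine ⟨i1.prod hε hs hsep hne (h.moments (by omega) h2) hint, ?_⟩
    filter_upwards [hab] with x hx
    rw [enorm_mul, hx, show ‖sgn (σ (j + (d + 1)))‖ₑ = 1 by rcases hε with hε | hε <;> simp [hε],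
      one_mul]

lemma IsNikishin.hasNiceDensity (h : IsNikishin m σ) {j k : ℕ} (h1 : 1 ≤ j) (h2 : j ≤ m)
    (h3 : 1 ≤ k) (h4 : k ≤ m) :
    HasNiceDensity (sMeas σ j k) (σ j).variation (dens σ j k) := by
  rcases le_total j k with hjk | hjk
  · obtain ⟨d, rfl⟩ := Nat.exists_eq_add_of_le hjk
    exact (hasNiceDensity_forward h d j h1 h4).1
  · obtain ⟨d, rfl⟩ := Nat.exists_eq_add_of_le hjk
    exact (hasNiceDensity_backward h d k h3 h2).1

end System

/-! ### Cauchy transforms and their order at infinity -/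

/-- The Cauchy transform of the complex density `G` with respect to `μ`. -/
def ct (μ : Measure ℝ) (G : ℝ → ℂ) (z : ℂ) : ℂ := ∫ x, G x * (z - (x : ℂ))⁻¹ ∂μ

/-- All moments of the density `G` with respect to `μ` exist. -/
def HasMoments (μ : Measure ℝ) (G : ℝ → ℂ) : Prop :=
  ∀ ν : ℕ, Integrable (fun x : ℝ => (x : ℂ) ^ ν * G x) μ

lemma HasMoments.integrable {μ : Measure ℝ} {G : ℝ → ℂ} (h : HasMoments μ G) : Integrable G μ := by
  simpa using h 0

lemma HasMoments.pow_mul {μ : Measure ℝ} {G : ℝ → ℂ} (h : HasMoments μ G) (k : ℕ) :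
    HasMoments μ fun x : ℝ => (x : ℂ) ^ k * G x := by
  intro ν
  refine (h (ν + k)).congr (Eventually.of_forall fun x => ?_)
  ring

lemma HasMoments.const_mul {μ : Measure ℝ} {G : ℝ → ℂ} (h : HasMoments μ G) (c : ℂ) :
    HasMoments μ fun x => c * G x := by
  intro ν
  refine ((h ν).const_mul c).congr (Eventually.of_forall fun x => ?_)
  ring

lemma HasMoments.sum {ι : Type*} {s : Finset ι} {μ : Measure ℝ} {G : ι → ℝ → ℂ}
    (h : ∀ i ∈ s, HasMoments μ (G i)) : HasMoments μ fun x => ∑ i ∈ s, G i x := by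
  intro ν
  refine (integrable_finsetSum s fun i hi => h i hi ν).congr (Eventually.of_forall fun x => ?_)
  simp only [Finset.mul_sum]

lemma HasMoments.eval_mul {μ : Measure ℝ} {G : ℝ → ℂ} (h : HasMoments μ G) (p : ℂ[X]) :
    HasMoments μ fun x : ℝ => p.eval (x : ℂ) * G x := by
  have := HasMoments.sum (s := Finset.range (p.natDegree + 1))
    fun i _ => (h.pow_mul i).const_mul (p.coeff i)
  intro ν
  refine (this ν).congr (Eventually.of_forall fun x => ?_)
  simp only
  rw [eval_eq_sum_range, Finset.sum_mul]
  congr 1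
  exact Finset.sum_congr rfl fun i _ => by ring

lemma HasMoments.congr {μ : Measure ℝ} {G H : ℝ → ℂ} (h : HasMoments μ G)
    (e : G =ᵐ[μ] H) : HasMoments μ H := by
  intro ν
  refine (h ν).congr ?_
  filter_upwards [e] with x hx
  rw [hx]

lemma ct_congr {μ : Measure ℝ} {G H : ℝ → ℂ} (e : G =ᵐ[μ] H) (z : ℂ) : ct μ G z = ct μ H z := by
  refine integral_congr_ae ?_
  filter_upwards [e] with x hx
  rw [hx]

lemma ct_const_mul (μ : Measure ℝ) (c : ℂ) (G : ℝ → ℂ) (z : ℂ) :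
    ct μ (fun x => c * G x) z = c * ct μ G z := by
  simp only [ct, mul_assoc, integral_const_mul]

lemma Away.ct_sum {ι : Type*} {s : Finset ι} {μ : Measure ℝ} {G : ι → ℝ → ℂ} {z : ℂ}
    (hz : Away μ z) (h : ∀ i ∈ s, Integrable (G i) μ) :
    ct μ (fun x => ∑ i ∈ s, G i x) z = ∑ i ∈ s, ct μ (G i) z := by
  simp only [ct, Finset.sum_mul]
  exact integral_finsetSum _ fun i hi => hz.integrable_mul_inv (h i hi)

/-- Integrate z/(z − x) = 1 + x/(z − x). -/
lemma Away.mul_ct {μ : Measure ℝ} {G : ℝ → ℂ} {z : ℂ} (hz : Away μ z) (hG : HasMoments μ G) :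
    z * ct μ G z = ∫ x, G x ∂μ + ct μ (fun x : ℝ => (x : ℂ) * G x) z := by
  have h1 : Integrable (fun x : ℝ => (x : ℂ) * G x) μ := by simpa using hG 1
  rw [ct, ct, ← integral_const_mul, ← integral_add hG.integrable (hz.integrable_mul_inv h1)]
  refine integral_congr_ae ?_
  obtain ⟨δ, hδ, h⟩ := hz
  filter_upwards [h] with x hx
  have : z - (x : ℂ) ≠ 0 := by
    intro h0
    rw [h0, norm_zero] at hx
    linarith
  field_simp
  ring

lemma Away.pow_mul_ct {μ : Measure ℝ} {G : ℝ → ℂ} {z : ℂ} (hz : Away μ z)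
    (hG : HasMoments μ G) {n : ℕ} (ho : ∀ ν < n, ∫ x, (x : ℂ) ^ ν * G x ∂μ = 0) :
    z ^ n * ct μ G z = ct μ (fun x : ℝ => (x : ℂ) ^ n * G x) z := by
  induction n with
  | zero => simp
  | succ n ih =>
    rw [pow_succ', mul_assoc, ih fun ν hν => ho ν (by omega), hz.mul_ct (hG.pow_mul n),
      ho n (by omega), zero_add]
    simp only [← mul_assoc, ← pow_succ']

lemma norm_ct_le {μ : Measure ℝ} {G : ℝ → ℂ} {z : ℂ} {δ : ℝ} (hδ : 0 < δ)
    (h : ∀ᵐ x : ℝ ∂μ, δ ≤ ‖z - (x : ℂ)‖) (hG : Integrable G μ) :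
    ‖ct μ G z‖ ≤ (∫ x, ‖G x‖ ∂μ) / δ := by
  rw [div_eq_mul_inv, ← integral_mul_const]
  refine norm_integral_le_of_norm_le (hG.norm.mul_const _) ?_
  filter_upwards [h] with x hx
  rw [norm_mul, norm_inv]
  gcongr

lemma away_of_region {μ : Measure ℝ} {Δ : Set ℝ} (hΔ : ∀ᵐ x ∂μ, x ∈ Δ) {δ : ℝ} {z : ℂ}
    (hz : δ * ‖z‖ ≤ Metric.infDist z ((fun x : ℝ => (x : ℂ)) '' Δ)) :
    ∀ᵐ x : ℝ ∂μ, δ * ‖z‖ ≤ ‖z - (x : ℂ)‖ := by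
  filter_upwards [hΔ] with x hx
  rw [← dist_eq_norm]
  exact hz.trans (Metric.infDist_le_dist_of_mem ⟨x, hx, rfl⟩)

/-- Vanishing moments let z^n be absorbed as x^n under the integral, and in the region |z − x| ≥
δ|z| the resulting transform is at most a constant over |z|. -/
lemma isONontangential_of_eq {μ : Measure ℝ} {Δ : Set ℝ} (hΔ : ∀ᵐ x ∂μ, x ∈ Δ) {G : ℝ → ℂ}
    (hG : HasMoments μ G) {f : ℂ → ℂ} (hf : ∀ z, Away μ z → f z = ct μ G z) {n : ℕ}
    (ho : ∀ ν < n, ∫ x, (x : ℂ) ^ ν * G x ∂μ = 0) : IsONontangential Δ f (n + 1) := by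
  intro δ hδ
  refine IsBigO.of_bound ((∫ x, ‖(x : ℂ) ^ n * G x‖ ∂μ) / δ) ?_
  have h1 : ∀ᶠ z : ℂ in Bornology.cobounded ℂ, 0 < ‖z‖ :=
    tendsto_norm_cobounded_atTop.eventually (eventually_gt_atTop 0)
  rw [eventually_inf_principal]
  filter_upwards [h1] with z hz hzr
  have h2 := away_of_region hΔ hzr
  have h3 : 0 < δ * ‖z‖ := mul_pos hδ hz
  have haw : Away μ z := ⟨_, h3, h2⟩
  have h4 := norm_ct_le h3 h2 (hG n)
  rw [← haw.pow_mul_ct hG ho, norm_mul, norm_pow] at h4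
  rw [hf z haw, norm_div, norm_pow, norm_one]
  have h5 : 0 < ‖z‖ ^ n := by positivity
  rw [← mul_le_mul_iff_right₀ h5]
  refine h4.trans (le_of_eq ?_)
  field_simp
  ring

/-- The upward imaginary axis. -/
def axis (y : ℝ) : ℂ := y * Complex.I

lemma axis_im (y : ℝ) : (axis y).im = y := by simp [axis]

lemma norm_axis (y : ℝ) : ‖axis y‖ = |y| := by simp [axis]

lemma tendsto_ct_axis {μ : Measure ℝ} {G : ℝ → ℂ} (hG : Integrable G μ) :
    Tendsto (fun y => ct μ G (axis y)) atTop (𝓝 0) := by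
  have h : Tendsto (fun y : ℝ => (∫ x, ‖G x‖ ∂μ) / y) atTop (𝓝 0) :=
    tendsto_const_nhds.div_atTop tendsto_id
  refine squeeze_zero_norm' ?_ h
  filter_upwards [eventually_gt_atTop 0] with y hy
  refine norm_ct_le hy (Eventually.of_forall fun x => ?_) hG
  have := Complex.abs_im_le_norm (axis y - (x : ℂ))
  simp only [Complex.sub_im, Complex.ofReal_im, sub_zero, axis_im] at this
  exact (le_abs_self y).trans this

/-- For nonempty Δ the imaginary axis lies in the region with δ = 1, because |iy − x| ≥ |y|. All
converse statements are tested only along this axis. -/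
lemma IsONontangential.axis {Δ : Set ℝ} (hΔ : Δ.Nonempty) {f : ℂ → ℂ} {k : ℕ}
    (h : IsONontangential Δ f k) :
    (fun y => f (axis y)) =O[atTop] fun y => 1 / (Nikishin.axis y) ^ k := by
  refine (h 1 one_pos).comp_tendsto ?_
  rw [tendsto_inf]
  constructor
  · rw [← tendsto_norm_atTop_iff_cobounded]
    simp only [norm_axis]
    exact tendsto_abs_atTop_atTop
  · rw [tendsto_principal]
    refine Eventually.of_forall fun y => ?_
    simp only [Set.mem_ofPred_eq, one_mul]
    rw [Metric.le_infDist (hΔ.image _)]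
    rintro _ ⟨x, -, rfl⟩
    rw [dist_eq_norm, norm_axis]
    have := Complex.abs_im_le_norm (Nikishin.axis y - (x : ℂ))
    simpa only [Complex.sub_im, Complex.ofReal_im, sub_zero, axis_im] using this

lemma tendsto_axis_of_isBigO {f : ℝ → ℂ} {k : ℕ}
    (h : f =O[atTop] fun y => 1 / (axis y) ^ (k + 1)) {i : ℕ} (hi : i ≤ k) :
    Tendsto (fun y => (axis y) ^ i * f y) atTop (𝓝 0) := by
  have h1 : (fun y => (axis y) ^ i * f y) =O[atTop]
      fun y => (axis y) ^ i * (1 / (axis y) ^ (k + 1)) := (isBigO_refl _ _).mul h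
  refine h1.trans_tendsto ?_
  have h2 : Tendsto (fun y : ℝ => 1 / y ^ (k + 1 - i)) atTop (𝓝 0) :=
    tendsto_const_nhds.div_atTop (tendsto_pow_atTop (by omega))
  refine squeeze_zero_norm' ?_ h2
  filter_upwards [eventually_gt_atTop 0] with y hy
  rw [norm_mul, norm_div, norm_pow, norm_pow, norm_one, norm_axis, abs_of_pos hy,
    show k + 1 = (k + 1 - i) + i by omega, pow_add, Nat.add_sub_cancel]
  refine le_of_eq ?_
  field_simp

lemma eq_zero_of_tendsto_axis {p : ℂ[X]}
    (h : Tendsto (fun y => p.eval (axis y)) atTop (𝓝 0)) : p = 0 := by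
  by_contra hp
  rcases Nat.eq_zero_or_pos p.natDegree with h0 | h0
  · rw [eq_C_of_natDegree_eq_zero h0] at h hp
    simp only [eval_C] at h
    rw [tendsto_const_nhds_iff] at h
    exact hp (by rw [h, C_0])
  · have h1 : Tendsto (fun y => ‖p.eval (axis y)‖) atTop atTop :=
      p.tendsto_norm_atTop (natDegree_pos_iff_degree_pos.1 h0)
        (by simpa only [norm_axis] using tendsto_abs_atTop_atTop)
    exact not_tendsto_nhds_of_tendsto_atTop h1 _ h.norm

/-- A polynomial plus a Cauchy transform decays to order `n + 1` precisely when the polynomial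
vanishes and the density has `n` vanishing moments. -/
lemma isONontangential_iff {μ : Measure ℝ} {Δ : Set ℝ} (hne : Δ.Nonempty)
    (hΔ : ∀ᵐ x ∂μ, x ∈ Δ) {G : ℝ → ℂ} (hG : HasMoments μ G) {f : ℂ → ℂ} {p : ℂ[X]}
    (hf : ∀ z, Away μ z → f z = p.eval z + ct μ G z) {n : ℕ} :
    IsONontangential Δ f (n + 1) ↔ p = 0 ∧ ∀ ν < n, ∫ x, (x : ℂ) ^ ν * G x ∂μ = 0 := by
  constructor
  · intro h
    have hax := h.axis hne
    have haway : ∀ᶠ y in atTop, Away μ (axis y) := by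
      filter_upwards [eventually_gt_atTop 0] with y hy
      exact away_of_im_ne_zero μ (by rw [axis_im]; exact hy.ne')
    have hp : p = 0 := by
      apply eq_zero_of_tendsto_axis
      have h1 := tendsto_axis_of_isBigO hax (Nat.zero_le n)
      have h2 := h1.sub (tendsto_ct_axis hG.integrable)
      rw [sub_zero] at h2
      refine h2.congr' ?_
      filter_upwards [haway] with y hy
      rw [hf _ hy]
      ring
    refine ⟨hp, ?_⟩
    intro ν
    induction ν using Nat.strong_induction_on with
    | _ ν ih =>
      intro hν
      -- Once the earlier moments vanish, z^{ν+1} f(z) tends to the ν-th moment along the axis,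
      -- while the assumed order forces the limit 0.
      have h1 := tendsto_axis_of_isBigO hax (show ν + 1 ≤ n by omega)
      have h2 : Tendsto (fun y => (axis y) ^ (ν + 1) * f (axis y)) atTop
          (𝓝 (∫ x, (x : ℂ) ^ ν * G x ∂μ + 0)) := by
        have h3 : Integrable (fun x : ℝ => (x : ℂ) * ((x : ℂ) ^ ν * G x)) μ := by
          simpa using (hG.pow_mul ν) 1
        refine (tendsto_const_nhds.add (tendsto_ct_axis h3)).congr' ?_
        filter_upwards [haway] with y hy
        rw [hf _ hy, hp, eval_zero, zero_add, pow_succ', mul_assoc,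
          hy.pow_mul_ct hG fun k hk => ih k hk (by omega), hy.mul_ct (hG.pow_mul ν)]
      rw [add_zero] at h2
      exact tendsto_nhds_unique h2 h1
  · rintro ⟨rfl, ho⟩
    exact isONontangential_of_eq hΔ hG (fun z hz => by rw [hf z hz, eval_zero, zero_add]) ho

/-! ### Polynomial part of a polynomial times a Cauchy transform -/

section PolyPart

variable {K : Type*} [CommRing K]

/-- The polynomial part of `z ^ i * ∑ M_k z⁻¹⁻ᵏ`. -/
def monomialPart (M : ℕ → K) : ℕ → K[X]
  | 0 => 0
  | i + 1 => X * monomialPart M i + C (M i)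

/-- The polynomial part of `p(z) * ∑ M_k z⁻¹⁻ᵏ`. -/
def polyPart (M : ℕ → K) : K[X] →ₗ[K] K[X] :=
  Polynomial.lsum fun i => LinearMap.toSpanSingleton K K[X] (monomialPart M i)

/-- The linear functional with moments `M`. -/
def momentFunctional (M : ℕ → K) : K[X] →ₗ[K] K :=
  Polynomial.lsum fun i => LinearMap.toSpanSingleton K K (M i)

lemma polyPart_monomial (M : ℕ → K) (i : ℕ) (c : K) :
    polyPart M (monomial i c) = c • monomialPart M i := by
  simp [polyPart, lsum_apply, sum_monomial_index]

lemma momentFunctional_monomial (M : ℕ → K) (i : ℕ) (c : K) :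
    momentFunctional M (monomial i c) = c * M i := by
  simp [momentFunctional, lsum_apply, sum_monomial_index]

lemma polyPart_eq_sum (M : ℕ → K) (p : K[X]) :
    polyPart M p = ∑ i ∈ p.support, p.coeff i • monomialPart M i := by
  simp [polyPart, lsum_apply, Polynomial.sum]

lemma degree_monomialPart_lt (M : ℕ → K) (i : ℕ) : (monomialPart M i).degree < i := by
  induction i with
  | zero => simp [monomialPart]
  | succ i ih =>
    rw [degree_lt_iff_coeff_zero] at ih ⊢
    intro k hk
    obtain ⟨k, rfl⟩ : ∃ l, k = l + 1 := ⟨k - 1, by omega⟩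
    rw [monomialPart, coeff_add, coeff_X_mul, ih k (by omega), coeff_C_succ, add_zero]

lemma coeff_monomialPart (M : ℕ → K) (i : ℕ) : (monomialPart M (i + 1)).coeff i = M 0 := by
  induction i with
  | zero => simp [monomialPart]
  | succ i ih => rw [monomialPart, coeff_add, coeff_X_mul, ih, coeff_C_succ, add_zero]

lemma degree_polyPart_lt (M : ℕ → K) {p : K[X]} {n : ℕ} (hp : p.degree ≤ n) :
    (polyPart M p).degree < n := by
  rw [polyPart_eq_sum, ← mem_degreeLT]
  refine Submodule.sum_mem _ fun i hi => ?_
  rw [mem_degreeLT]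
  refine (degree_smul_le _ _).trans_lt ((degree_monomialPart_lt M i).trans_le ?_)
  exact (le_degree_of_mem_supp i hi).trans hp

lemma coeff_polyPart (M : ℕ → K) {p : K[X]} {n : ℕ} (hp : p.degree ≤ (n + 1 : ℕ)) :
    (polyPart M p).coeff n = p.coeff (n + 1) * M 0 := by
  rw [polyPart_eq_sum, finsetSum_coeff]
  rw [Finset.sum_eq_single (n + 1)]
  · rw [coeff_smul, coeff_monomialPart, smul_eq_mul]
  · intro i hi hne
    have h1 : (i : WithBot ℕ) ≤ (n + 1 : ℕ) := (le_degree_of_mem_supp i hi).trans hp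
    have h2 : i ≤ n := by
      have : i ≤ n + 1 := by exact_mod_cast h1
      omega
    rw [coeff_smul, coeff_eq_zero_of_degree_lt ((degree_monomialPart_lt M i).trans_le
      (by exact_mod_cast h2)), smul_zero]
  · intro hn
    rw [notMem_support_iff.1 hn, zero_smul, coeff_zero]

/-- The polynomial part at z is formally ∫ (p(z) − p(x))/(z − x) dμ(x). At a root z of p = (X − z) l
the integrand reduces to l(x). -/
lemma eval_polyPart_X_sub_C_mul (M : ℕ → K) (l : K[X]) (z : K) :
    (polyPart M ((X - C z) * l)).eval z = momentFunctional M l := by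
  induction l using Polynomial.induction_on' with
  | add p q hp hq => rw [mul_add, map_add, eval_add, hp, hq, map_add]
  | monomial i c =>
    have : (X - C z) * monomial i c = monomial (i + 1) c - z • monomial i c := by
      rw [sub_mul, X_mul_monomial, ← smul_eq_C_mul]
    rw [this, map_sub, map_smul, polyPart_monomial, polyPart_monomial, momentFunctional_monomial,
      monomialPart]
    simp only [eval_sub, eval_smul, eval_add, eval_mul, eval_X, eval_C, smul_eq_mul]
    ring

lemma map_polyPart {L : Type*} [CommRing L] (f : K →+* L) (M : ℕ → K) (p : K[X]) :
    (polyPart M p).map f = polyPart (fun i => f (M i)) (p.map f) := by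
  have h : ∀ i, (monomialPart M i).map f = monomialPart (fun i => f (M i)) i := by
    intro i
    induction i with
    | zero => simp [monomialPart]
    | succ i ih => simp [monomialPart, ih]
  induction p using Polynomial.induction_on' with
  | add p q hp hq => simp only [map_add, Polynomial.map_add, hp, hq]
  | monomial i c => simp [polyPart_monomial, h, Polynomial.map_smul]

end PolyPart

lemma momentFunctional_eq_integral {μ : Measure ℝ} {G : ℝ → ℂ} (hG : HasMoments μ G) (p : ℂ[X]) :
    momentFunctional (fun k => ∫ x, (x : ℂ) ^ k * G x ∂μ) p = ∫ x, p.eval (x : ℂ) * G x ∂μ := by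
  induction p using Polynomial.induction_on' with
  | add p q hp hq =>
    simp only [map_add, hp, hq, eval_add, add_mul]
    rw [integral_add (hG.eval_mul p).integrable (hG.eval_mul q).integrable]
  | monomial i c =>
    simp only [momentFunctional_monomial, eval_monomial, mul_assoc, integral_const_mul]

lemma Away.eval_mul_ct {μ : Measure ℝ} {G : ℝ → ℂ} {z : ℂ} (hz : Away μ z)
    (hG : HasMoments μ G) (p : ℂ[X]) :
    p.eval z * ct μ G z = (polyPart (fun k => ∫ x, (x : ℂ) ^ k * G x ∂μ) p).eval z +
      ct μ (fun x : ℝ => p.eval (x : ℂ) * G x) z := by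
  have key : ∀ i : ℕ, z ^ i * ct μ G z =
      (monomialPart (fun k => ∫ x, (x : ℂ) ^ k * G x ∂μ) i).eval z +
        ct μ (fun x : ℝ => (x : ℂ) ^ i * G x) z := by
    intro i
    induction i with
    | zero => simp [monomialPart]
    | succ i ih =>
      rw [pow_succ', mul_assoc, ih, mul_add, hz.mul_ct (hG.pow_mul i), monomialPart]
      simp only [eval_add, eval_mul, eval_X, eval_C, ← mul_assoc, ← pow_succ']
      ring
  induction p using Polynomial.induction_on' with
  | add p q hp hq =>
    have : ct μ (fun x => (p + q).eval (x : ℂ) * G x) z =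
        ct μ (fun x : ℝ => p.eval (x : ℂ) * G x) z + ct μ (fun x => q.eval (x : ℂ) * G x) z := by
      rw [ct, ct, ct, ← integral_add (hz.integrable_mul_inv (hG.eval_mul p).integrable)
        (hz.integrable_mul_inv (hG.eval_mul q).integrable)]
      simp only [eval_add, add_mul]
    rw [this, map_add, eval_add, eval_add, add_mul, hp, hq]
    ring
  | monomial i c =>
    simp only [polyPart_monomial, eval_monomial, eval_smul, smul_eq_mul, mul_assoc]
    rw [key i, ct_const_mul]
    ring

/-! ### The multi-level and reversed forms as polynomial part plus Cauchy transform -/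

section System

variable {m : ℕ} {σ : ℕ → SignedMeasure ℝ}

lemma ae_mem_hull (σ : ℕ → SignedMeasure ℝ) (j : ℕ) : ∀ᵐ x ∂(σ j).variation, x ∈ hull σ j := by
  have : ∀ᵐ x ∂(σ j).variation, x ∈ (σ j).variation.support := Measure.support_mem_ae
  filter_upwards [this] with x hx
  exact subset_convexHull ℝ _ hx

lemma IsNikishin.hull_nonempty (h : IsNikishin m σ) {j : ℕ} (h1 : 1 ≤ j) (h2 : j ≤ m) :
    (hull σ j).Nonempty :=
  (h.mem j h1 h2).infinite_supp.nonempty.mono (subset_convexHull ℝ _)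

lemma IsNikishin.hasMoments_dens (h : IsNikishin m σ) {j k : ℕ} (h1 : 1 ≤ j) (h2 : j ≤ m)
    (h3 : 1 ≤ k) (h4 : k ≤ m) :
    HasMoments (σ j).variation fun x => (dens σ j k x : ℂ) := by
  intro ν
  have := ((h.hasNiceDensity h1 h2 h3 h4).moments ν).ofReal (𝕜 := ℂ)
  simpa using this

lemma IsNikishin.cauchy_eq_ct (h : IsNikishin m σ) {j k : ℕ} (h1 : 1 ≤ j) (h2 : j ≤ m)
    (h3 : 1 ≤ k) (h4 : k ≤ m) (z : ℂ) :
    cauchy (sMeas σ j k) z = ct (σ j).variation (fun x => (dens σ j k x : ℂ)) z :=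
  (h.hasNiceDensity h1 h2 h3 h4).cauchy_eq z

/-- The moments of `s_{j,k}`. -/
def mom (σ : ℕ → SignedMeasure ℝ) (j k i : ℕ) : ℂ :=
  ∫ x, (x : ℂ) ^ i * (dens σ j k x : ℂ) ∂(σ j).variation

lemma IsNikishin.eval_mul_cauchy (h : IsNikishin m σ) {j k : ℕ} (h1 : 1 ≤ j) (h2 : j ≤ m)
    (h3 : 1 ≤ k) (h4 : k ≤ m) {z : ℂ} (hz : Away (σ j).variation z) (p : ℂ[X]) :
    p.eval z * cauchy (sMeas σ j k) z = (polyPart (mom σ j k) p).eval z +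
      ct (σ j).variation (fun x : ℝ => p.eval (x : ℂ) * (dens σ j k x : ℂ)) z := by
  rw [h.cauchy_eq_ct h1 h2 h3 h4]
  exact hz.eval_mul_ct (h.hasMoments_dens h1 h2 h3 h4) p

/-- The polynomial part of the form `𝓐_j`. -/
def levelPoly (m : ℕ) (σ : ℕ → SignedMeasure ℝ) (a : ℕ → ℂ[X]) (j : ℕ) : ℂ[X] :=
  (-1 : ℂ) ^ j • a j +
    ∑ k ∈ Finset.Icc (j + 1) m, (-1 : ℂ) ^ k • polyPart (mom σ (j + 1) k) (a k)

/-- The density with respect to the variation of `σ_j` of the measure `𝓐_j dσ_j`. -/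
def levelDensity (m : ℕ) (σ : ℕ → SignedMeasure ℝ) (a : ℕ → ℂ[X]) (j : ℕ) (x : ℝ) : ℂ :=
  (sgn (σ j) : ℂ) * levelForm m σ a j x

lemma levelForm_last (m : ℕ) (σ : ℕ → SignedMeasure ℝ) (a : ℕ → ℂ[X]) (z : ℂ) :
    levelForm m σ a m z = (-1) ^ m * (a m).eval z := by
  simp [levelForm]

/-- The density of s_{j+1,k} is the sign of σ_{j+1} times ŝ_{j+2,k}, or times 1 if k = j + 1, so the
densities assemble into a form of the next level. The coefficients are arbitrary because both the
values of the a_k and those of the reversed transforms are inserted. -/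
lemma IsNikishin.sum_dens (h : IsNikishin m σ) {j : ℕ} (hj : j < m) (c : ℕ → ℂ) (x : ℝ) :
    ∑ k ∈ Finset.Icc (j + 1) m, (-1) ^ k * c k * (dens σ (j + 1) k x : ℂ) =
      (sgn (σ (j + 1)) : ℂ) * ((-1) ^ (j + 1) * c (j + 1) +
        ∑ k ∈ Finset.Icc (j + 1 + 1) m, (-1) ^ k * c k * cauchy (sMeas σ (j + 1 + 1) k) x) := by
  rw [← Finset.insert_Icc_add_one_left_eq_Icc (show j + 1 ≤ m by omega),
    Finset.sum_insert (by simp), mul_add, Finset.mul_sum]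
  congr 1
  · simp [dens, mul_comm]
  · refine Finset.sum_congr rfl fun k hk => ?_
    rw [Finset.mem_Icc] at hk
    rw [(h.hasNiceDensity (show 1 ≤ j + 1 + 1 by omega) (by omega) (by omega) hk.2).cauchy_ofReal,
      dens, if_neg (by omega), if_pos (by omega)]
    push_cast
    ring

lemma IsNikishin.levelDensity_eq_sum (h : IsNikishin m σ) {j : ℕ} (hj : j < m) (a : ℕ → ℂ[X])
    (x : ℝ) : levelDensity m σ a (j + 1) x =
      ∑ k ∈ Finset.Icc (j + 1) m, (-1) ^ k * ((a k).eval (x : ℂ) * (dens σ (j + 1) k x : ℂ)) := by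
  rw [levelDensity, levelForm, ← h.sum_dens hj fun k => (a k).eval (x : ℂ)]
  exact Finset.sum_congr rfl fun k _ => by ring

lemma IsNikishin.hasMoments_levelDensity (h : IsNikishin m σ) {j : ℕ} (hj : j < m)
    (a : ℕ → ℂ[X]) : HasMoments (σ (j + 1)).variation (levelDensity m σ a (j + 1)) := by
  refine HasMoments.congr (HasMoments.sum (s := Finset.Icc (j + 1) m) fun k hk => ?_)
    (Eventually.of_forall fun x => (h.levelDensity_eq_sum hj a x).symm)
  rw [Finset.mem_Icc] at hk
  exact ((h.hasMoments_dens (by omega) (by omega) (by omega) hk.2).eval_mul (a k)).const_mul _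

/-- This recursion from level j to level j + 1 drives the zero counting: once the polynomial part
vanishes, 𝓐_j is the Cauchy transform of 𝓐_{j+1} dσ_{j+1}. -/
lemma IsNikishin.levelForm_eq (h : IsNikishin m σ) {j : ℕ} (hj : j < m) (a : ℕ → ℂ[X]) {z : ℂ}
    (hz : Away (σ (j + 1)).variation z) :
    levelForm m σ a j z = (levelPoly m σ a j).eval z +
      ct (σ (j + 1)).variation (levelDensity m σ a (j + 1)) z := by
  have e : levelDensity m σ a (j + 1) = fun x : ℝ => ∑ k ∈ Finset.Icc (j + 1) m,
      (-1) ^ k * ((a k).eval (x : ℂ) * (dens σ (j + 1) k x : ℂ)) :=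
    funext (h.levelDensity_eq_sum hj a)
  rw [e, hz.ct_sum, levelForm, levelPoly]
  · simp only [eval_add, eval_smul, eval_finsetSum, smul_eq_mul]
    rw [add_assoc, ← Finset.sum_add_distrib]
    congr 1
    refine Finset.sum_congr rfl fun k hk => ?_
    rw [Finset.mem_Icc] at hk
    rw [mul_assoc, h.eval_mul_cauchy (by omega) (by omega) (by omega) hk.2 hz, ct_const_mul]
    ring
  · intro k hk
    rw [Finset.mem_Icc] at hk
    exact (((h.hasMoments_dens (by omega) (by omega) (by omega) hk.2).eval_mul
      (a k)).const_mul _).integrable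

/-- The polynomial parts of the forms `𝓐_0, …, 𝓐_{m-1}` vanish and `𝓐_1 dσ_1` has `n` vanishing
moments. -/
structure IsSolution (m : ℕ) (σ : ℕ → SignedMeasure ℝ) (n : ℕ) (a : ℕ → ℂ[X]) : Prop where
  poly : ∀ j < m, levelPoly m σ a j = 0
  orth : ∀ ν < n, ∫ x, (x : ℂ) ^ ν * levelDensity m σ a 1 x ∂(σ 1).variation = 0

lemma IsNikishin.first_iff (h : IsNikishin m σ) (hm : 1 ≤ m) (n : ℕ) (a : ℕ → ℂ[X]) :
    IsONontangential (hull σ 1) (levelForm m σ a 0) (n + 1) ↔ levelPoly m σ a 0 = 0 ∧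
      ∀ ν < n, ∫ x, (x : ℂ) ^ ν * levelDensity m σ a 1 x ∂(σ 1).variation = 0 :=
  isONontangential_iff (h.hull_nonempty le_rfl hm) (ae_mem_hull σ 1)
    (h.hasMoments_levelDensity hm a) fun _ hz => h.levelForm_eq hm a hz

lemma IsNikishin.level_iff (h : IsNikishin m σ) {j : ℕ} (hj : j < m) (a : ℕ → ℂ[X]) :
    IsONontangential (hull σ (j + 1)) (levelForm m σ a j) 1 ↔ levelPoly m σ a j = 0 := by
  rw [isONontangential_iff (n := 0) (h.hull_nonempty (by omega) hj) (ae_mem_hull σ (j + 1))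
    (h.hasMoments_levelDensity hj a) fun _ hz => h.levelForm_eq hj a hz]
  simp

lemma IsNikishin.isML_iff (h : IsNikishin m σ) (hm : 1 ≤ m) (n : ℕ) (a : ℕ → ℂ[X]) :
    IsML m σ n a ↔ IsAdmissible m n a ∧ IsSolution m σ n a := by
  constructor
  · intro ha
    obtain ⟨h0, h1⟩ := (h.first_iff hm n a).1 ha.first
    refine ⟨ha.toIsAdmissible, ?_, h1⟩
    intro j hj
    rcases Nat.eq_zero_or_pos j with rfl | hj0
    · exact h0
    · exact (h.level_iff hj a).1 (ha.level j hj0 hj)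
  · rintro ⟨h0, h1⟩
    exact ⟨h0, (h.first_iff hm n a).2 ⟨h1.poly 0 hm, h1.orth⟩,
      fun j _ hj => (h.level_iff hj a).2 (h1.poly j hj)⟩

/-- The form `a_j - a_m ŝ_{m,j+1}`. -/
def reversedForm (m : ℕ) (σ : ℕ → SignedMeasure ℝ) (a : ℕ → ℂ[X]) (j : ℕ) (z : ℂ) : ℂ :=
  (a j).eval z - (a m).eval z * cauchy (sMeas σ m (j + 1)) z

lemma IsNikishin.reversedForm_eq (h : IsNikishin m σ) {j : ℕ} (hj : j < m) (a : ℕ → ℂ[X]) {z : ℂ}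
    (hz : Away (σ m).variation z) :
    reversedForm m σ a j z = (a j - polyPart (mom σ m (j + 1)) (a m)).eval z +
      ct (σ m).variation
        (fun x => (-1) * ((a m).eval (x : ℂ) * (dens σ m (j + 1) x : ℂ))) z := by
  rw [reversedForm, h.eval_mul_cauchy (by omega) le_rfl (by omega) (by omega) hz, ct_const_mul,
    eval_sub]
  ring

lemma IsNikishin.hasMoments_reversed (h : IsNikishin m σ) {j : ℕ} (hj : j < m) (a : ℕ → ℂ[X]) :
    HasMoments (σ m).variation
      fun x => (-1) * ((a m).eval (x : ℂ) * (dens σ m (j + 1) x : ℂ)) :=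
  ((h.hasMoments_dens (by omega) le_rfl (by omega) (by omega)).eval_mul (a m)).const_mul _

lemma IsNikishin.reversed_iff (h : IsNikishin m σ) {j : ℕ} (hj : j < m) (a : ℕ → ℂ[X]) :
    IsONontangential (hull σ m)
      (fun z => (-1) ^ j * ((a j).eval z - (a m).eval z * cauchy (sMeas σ m (j + 1)) z)) 1 ↔
    a j = polyPart (mom σ m (j + 1)) (a m) := by
  rw [isONontangential_iff (n := 0) (p := (-1 : ℂ) ^ j • (a j - polyPart (mom σ m (j + 1)) (a m)))
    (h.hull_nonempty (by omega) le_rfl) (ae_mem_hull σ m)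
    ((h.hasMoments_reversed hj a).const_mul ((-1) ^ j))]
  · simp [sub_eq_zero]
  · intro z hz
    have := h.reversedForm_eq hj a hz
    rw [reversedForm] at this
    rw [this, ct_const_mul _ ((-1) ^ j), eval_smul, smul_eq_mul]
    ring

lemma eq_zero_iff_tendsto_axis {μ : Measure ℝ} {G : ℝ → ℂ} (hG : Integrable G μ) {f : ℂ → ℂ}
    {p : ℂ[X]} (hf : ∀ z, Away μ z → f z = p.eval z + ct μ G z) :
    p = 0 ↔ Tendsto (fun y => f (axis y)) atTop (𝓝 0) := by
  have haway : ∀ᶠ y in atTop, f (axis y) = p.eval (axis y) + ct μ G (axis y) := by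
    filter_upwards [eventually_gt_atTop 0] with y hy
    exact hf _ (away_of_im_ne_zero μ (by rw [axis_im]; exact hy.ne'))
  constructor
  · rintro rfl
    refine (tendsto_ct_axis hG).congr' ?_
    filter_upwards [haway] with y hy
    rw [hy, eval_zero, zero_add]
  · intro h
    apply eq_zero_of_tendsto_axis
    have := h.sub (tendsto_ct_axis hG)
    rw [sub_zero] at this
    refine this.congr' ?_
    filter_upwards [haway] with y hy
    rw [hy]
    ring

/-! ### The reversal identity and the equivalence of the two definitions -/

/-- The iterated Cauchy transform, with respect to `σ_j, …, σ_{j+d-1}`, of the function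
`x ↦ 1 / (z - x)`. -/
def resolvent (σ : ℕ → SignedMeasure ℝ) (z : ℂ) : ℕ → ℕ → ℂ → ℂ
  | 0, _, w => (z - w)⁻¹
  | d + 1, j, w =>
    ct (σ j).variation (fun y : ℝ => (sgn (σ j) : ℂ) * resolvent σ z d (j + 1) y) w

lemma measurable_resolvent (σ : ℕ → SignedMeasure ℝ) (z : ℂ) (d j : ℕ) :
    Measurable (resolvent σ z d j) := by
  induction d generalizing j with
  | zero =>
    change Measurable fun w => (z - w)⁻¹
    fun_prop
  | succ d ih =>
    have := ih (j + 1)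
    refine (StronglyMeasurable.integral_prod_right' (f := fun p : ℂ × ℝ =>
      ((sgn (σ j) : ℂ) * resolvent σ z d (j + 1) p.2) * (p.1 - p.2)⁻¹) ?_).measurable
    exact Measurable.stronglyMeasurable (by fun_prop)

lemma enorm_inv_le_inv_enorm (a : ℂ) : ‖a⁻¹‖ₑ ≤ ‖a‖ₑ⁻¹ := by
  rcases eq_or_ne a 0 with rfl | ha
  · simp
  · rw [enorm_inv ha]

lemma IsNikishin.enorm_sgn (h : IsNikishin m σ) {j : ℕ} (h1 : 1 ≤ j) (h2 : j ≤ m) :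
    ‖(sgn (σ j) : ℂ)‖ₑ = 1 := by
  rcases (h.sgn_spec h1 h2).1 with e | e <;> simp [e]

lemma IsNikishin.enorm_resolvent_le (h : IsNikishin m σ) (z : ℂ) (d : ℕ) :
    ∀ j, 1 ≤ j → j + d ≤ m + 1 → ∀ x : ℝ, ‖resolvent σ z d j x‖ₑ ≤
      ‖z.im‖ₑ⁻¹ * absForward (fun i => (σ i).variation) d j x := by
  induction d with
  | zero =>
    intro j h1 h2 x
    simp only [resolvent, absForward, mul_one]
    refine (enorm_inv_le_inv_enorm _).trans (ENNReal.inv_le_inv.2 ?_)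
    rw [← ofReal_norm, ← ofReal_norm]
    refine ENNReal.ofReal_le_ofReal ?_
    rw [Real.norm_eq_abs]
    have := Complex.abs_im_le_norm (z - (x : ℂ))
    simpa only [Complex.sub_im, Complex.ofReal_im, sub_zero] using this
  | succ d ih =>
    intro j h1 h2 x
    rw [resolvent, ct, absForward]
    refine (enorm_integral_le_lintegral_enorm _).trans ?_
    have hm := measurable_absForward (fun i => (σ i).variation) d (j + 1)
    rw [← lintegral_const_mul _ (by fun_prop)]
    refine lintegral_mono fun y => ?_
    rw [enorm_mul, enorm_mul, h.enorm_sgn h1 (by omega), one_mul]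
    have h3 : ‖((x : ℂ) - (y : ℂ))⁻¹‖ₑ ≤ ‖x - y‖ₑ⁻¹ := by
      refine (enorm_inv_le_inv_enorm _).trans (ENNReal.inv_le_inv.2 ?_)
      rw [← Complex.ofReal_sub, ← ofReal_norm, ← ofReal_norm, Complex.norm_real]
    calc _ ≤ (‖z.im‖ₑ⁻¹ * absForward (fun i => (σ i).variation) d (j + 1) y) * ‖x - y‖ₑ⁻¹ :=
          mul_le_mul' (ih (j + 1) (by omega) (by omega) y) h3
      _ = _ := by ring

lemma inv_enorm_im_lt_top {z : ℂ} (hz : z.im ≠ 0) : ‖z.im‖ₑ⁻¹ < ⊤ := by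
  rw [ENNReal.inv_lt_top, enorm_pos]
  exact hz

lemma IsNikishin.integrable_resolvent (h : IsNikishin m σ) {z : ℂ} (hz : z.im ≠ 0) {d j : ℕ}
    (h1 : 1 ≤ j) (h2 : j + d ≤ m) :
    Integrable (fun x : ℝ => resolvent σ z d (j + 1) x) (σ j).variation := by
  have hmeas := measurable_resolvent σ z d (j + 1)
  refine ⟨(by fun_prop : Measurable _).aestronglyMeasurable, ?_⟩
  refine (lintegral_mono (h.enorm_resolvent_le z d (j + 1) (by omega) (by omega))).trans_lt ?_
  rw [lintegral_const_mul _ (measurable_absForward _ _ _)]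
  exact ENNReal.mul_lt_top (inv_enorm_im_lt_top hz) (lintegral_absForward_lt_top h h1 h2)

/-- Fubini moves the kernel 1/(x − y) from the forward chain to the backward one, where it reads
1/(y − x); hence the minus sign. The integrand is dominated by |Im z|⁻¹ times the positive iterated
kernel, which is integrable. -/
lemma IsNikishin.integral_dens_mul_resolvent_step (h : IsNikishin m σ) {z : ℂ} (hz : z.im ≠ 0)
    {i e j : ℕ} (h1 : 1 ≤ j) (h2 : j + i + 1 + e ≤ m) :
    ∫ x : ℝ, (dens σ (j + i) j x : ℂ) * resolvent σ z (e + 1) (j + i + 1) x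
        ∂(σ (j + i)).variation =
      -∫ y : ℝ, (dens σ (j + i + 1) j y : ℂ) * resolvent σ z e (j + i + 1 + 1) y
        ∂(σ (j + i + 1)).variation := by
  have hd := h.hasNiceDensity (show 1 ≤ j + i by omega) (by omega) h1 (by omega)
  have hdm := hd.meas
  have hr := measurable_resolvent σ z e (j + i + 1 + 1)
  set s : ℂ := (sgn (σ (j + i + 1)) : ℂ) with hs
  have hint : Integrable (fun p : ℝ × ℝ => (dens σ (j + i) j p.1 : ℂ) *
      (s * resolvent σ z e (j + i + 1 + 1) p.2 * ((p.1 : ℂ) - (p.2 : ℂ))⁻¹))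
      ((σ (j + i)).variation.prod (σ (j + i + 1)).variation) := by
    refine ⟨(by fun_prop : Measurable _).aestronglyMeasurable, ?_⟩
    rw [HasFiniteIntegral, lintegral_prod _ (by fun_prop)]
    have hab := (hasNiceDensity_backward h i j h1 (by omega)).2
    have hle : ∀ᵐ x ∂(σ (j + i)).variation, ∫⁻ y, ‖(dens σ (j + i) j x : ℂ) *
        (s * resolvent σ z e (j + i + 1 + 1) y * ((x : ℂ) - (y : ℂ))⁻¹)‖ₑ
          ∂(σ (j + i + 1)).variation ≤
        ‖z.im‖ₑ⁻¹ * (absBackward (fun i => (σ i).variation) i j x *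
          absForward (fun i => (σ i).variation) (e + 1) (j + i + 1) x) := by
      filter_upwards [hab] with x hx
      have hfm := measurable_absForward (fun i => (σ i).variation) e (j + i + 1 + 1)
      rw [← hx, absForward, ← lintegral_const_mul _ (by fun_prop),
        ← lintegral_const_mul _ (by fun_prop)]
      refine lintegral_mono fun y => ?_
      rw [enorm_mul, enorm_mul, enorm_mul, hs, h.enorm_sgn (by omega) (by omega), one_mul]
      have h3 : ‖((x : ℂ) - (y : ℂ))⁻¹‖ₑ ≤ ‖x - y‖ₑ⁻¹ := by
        refine (enorm_inv_le_inv_enorm _).trans (ENNReal.inv_le_inv.2 ?_)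
        rw [← Complex.ofReal_sub, ← ofReal_norm, ← ofReal_norm, Complex.norm_real]
      have h4 : ‖(dens σ (j + i) j x : ℂ)‖ₑ = ‖dens σ (j + i) j x‖ₑ := by
        rw [← ofReal_norm, ← ofReal_norm, Complex.norm_real]
      rw [h4]
      calc _ ≤ ‖dens σ (j + i) j x‖ₑ * ((‖z.im‖ₑ⁻¹ *
            absForward (fun i => (σ i).variation) e (j + i + 1 + 1) y) * ‖x - y‖ₑ⁻¹) := by
            gcongr
            exact h.enorm_resolvent_le z e _ (by omega) (by omega) y
        _ = _ := by ring
    refine (lintegral_mono_ae hle).trans_lt ?_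
    have hB := measurable_absBackward (fun i => (σ i).variation) i j
    have hF := measurable_absForward (fun i => (σ i).variation) (e + 1) (j + i + 1)
    rw [lintegral_const_mul _ (by fun_prop),
      lintegral_absBackward_mul_absForward (fun i => (σ i).variation)]
    exact ENNReal.mul_lt_top (inv_enorm_im_lt_top hz) (lintegral_absForward_lt_top h h1 (by omega))
  have hd' : ∀ y : ℝ, (dens σ (j + i + 1) j y : ℂ) =
      s * ∫ x, (dens σ (j + i) j x : ℂ) * ((y : ℂ) - (x : ℂ))⁻¹ ∂(σ (j + i)).variation := by
    intro y
    rw [dens, if_neg (by omega), if_neg (by omega), ← hd.cauchy_eq, hd.cauchy_ofReal]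
    push_cast
    rfl
  calc _ = ∫ x : ℝ, ∫ y : ℝ, (dens σ (j + i) j x : ℂ) *
        (s * resolvent σ z e (j + i + 1 + 1) y * ((x : ℂ) - (y : ℂ))⁻¹)
          ∂(σ (j + i + 1)).variation ∂(σ (j + i)).variation := by
        refine integral_congr_ae (Eventually.of_forall fun x => ?_)
        simp only
        rw [resolvent, ct, integral_const_mul]
    _ = ∫ y : ℝ, ∫ x : ℝ, (dens σ (j + i) j x : ℂ) *
        (s * resolvent σ z e (j + i + 1 + 1) y * ((x : ℂ) - (y : ℂ))⁻¹)
          ∂(σ (j + i)).variation ∂(σ (j + i + 1)).variation := integral_integral_swap hint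
    _ = _ := by
        rw [← integral_neg]
        refine integral_congr_ae (Eventually.of_forall fun y => ?_)
        simp only
        rw [hd', mul_right_comm, ← integral_const_mul, ← integral_neg]
        refine integral_congr_ae (Eventually.of_forall fun x => ?_)
        simp only
        rw [← neg_sub (x : ℂ) (y : ℂ), inv_neg]
        ring

lemma IsNikishin.integral_dens_mul_resolvent (h : IsNikishin m σ) {z : ℂ} (hz : z.im ≠ 0)
    {j : ℕ} (h1 : 1 ≤ j) (i : ℕ) : ∀ e, j + i + e ≤ m →
    ∫ x : ℝ, (dens σ (j + i) j x : ℂ) * resolvent σ z e (j + i + 1) x ∂(σ (j + i)).variation =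
      (-1) ^ i * ∫ x : ℝ, (sgn (σ j) : ℂ) * resolvent σ z (i + e) (j + 1) x
        ∂(σ j).variation := by
  induction i with
  | zero =>
    intro e he
    simp [dens]
  | succ i ih =>
    intro e he
    have h3 := h.integral_dens_mul_resolvent_step hz (i := i) (e := e) h1 (by omega)
    rw [ih (e + 1) (by omega)] at h3
    rw [← add_assoc, pow_succ, mul_neg_one, neg_mul, show i + 1 + e = i + (e + 1) by ring, h3,
      neg_neg]

lemma IsNikishin.integral_resolvent (h : IsNikishin m σ) {z : ℂ} (hz : z.im ≠ 0) {j d : ℕ}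
    (h1 : 1 ≤ j) (h2 : j + d = m) :
    ∫ x : ℝ, (sgn (σ j) : ℂ) * resolvent σ z d (j + 1) x ∂(σ j).variation =
      (-1) ^ d * cauchy (sMeas σ m j) z := by
  have h3 := h.integral_dens_mul_resolvent hz h1 d 0 (by omega)
  rw [add_zero, h2] at h3
  rw [(h.hasNiceDensity (show 1 ≤ m by omega) le_rfl h1 (by omega)).cauchy_eq]
  simp only [resolvent] at h3
  rw [h3, ← mul_assoc, ← mul_pow]
  simp

/-- The Cauchy transform of `s_{m,k+1}`, understood as `1` if `k = m`. -/
def reversedCauchy (m : ℕ) (σ : ℕ → SignedMeasure ℝ) (z : ℂ) (k : ℕ) : ℂ :=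
  if k = m then 1 else cauchy (sMeas σ m (k + 1)) z

/-- Only w = z is wanted, where the right side vanishes, but the induction integrates the identity
of the next level over w on the support of σ_{j+1}, so a free w is needed. -/
lemma IsNikishin.sum_reversedCauchy (h : IsNikishin m σ) {z : ℂ} (hz : z.im ≠ 0) (d : ℕ) :
    ∀ j, j + d = m → ∀ w : ℂ, (d = 0 → w ≠ z) → (0 < d → Away (σ (j + 1)).variation w) →
    (-1) ^ j * reversedCauchy m σ z j + ∑ k ∈ Finset.Icc (j + 1) m,
        (-1) ^ k * reversedCauchy m σ z k * cauchy (sMeas σ (j + 1) k) w =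
      (-1) ^ m * (z - w) * resolvent σ z d (j + 1) w := by
  induction d with
  | zero =>
    intro j hj w hw _
    have : z - w ≠ 0 := sub_ne_zero.2 (hw rfl).symm
    obtain rfl : j = m := by omega
    simp [reversedCauchy, resolvent, mul_assoc, this]
  | succ d ih =>
    intro j hj w _ hw
    have haw := hw (Nat.succ_pos d)
    have hjm : j < m := by omega
    have hae : ∀ᵐ x : ℝ ∂(σ (j + 1)).variation,
        ∑ k ∈ Finset.Icc (j + 1) m,
          (-1) ^ k * reversedCauchy m σ z k * (dens σ (j + 1) k x : ℂ) =
        (-1) ^ m * ((z - x) * (sgn (σ (j + 1)) * resolvent σ z d (j + 1 + 1) x)) := by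
      have hA : ∀ᵐ x : ℝ ∂(σ (j + 1)).variation,
          0 < d → Away (σ (j + 1 + 1)).variation (x : ℂ) := by
        by_cases hd : 0 < d
        · filter_upwards [(h.separated (show 1 ≤ j + 1 by omega) (by omega)).away] with x hx _
          exact hx
        · exact Eventually.of_forall fun x hd' => absurd hd' hd
      filter_upwards [hA] with x hx
      rw [h.sum_dens hjm, ih (j + 1) (by omega) x (fun _ hxz => hz (by rw [← hxz]; simp)) hx]
      ring
    have hres : Integrable (fun x : ℝ =>
        (sgn (σ (j + 1)) : ℂ) * resolvent σ z d (j + 1 + 1) x) (σ (j + 1)).variation :=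
      (h.integrable_resolvent hz (by omega) (by omega)).const_mul _
    have hsum : ∑ k ∈ Finset.Icc (j + 1) m,
        (-1) ^ k * reversedCauchy m σ z k * cauchy (sMeas σ (j + 1) k) w =
        (-1) ^ m * (∫ x : ℝ, (sgn (σ (j + 1)) : ℂ) * resolvent σ z d (j + 1 + 1) x
          ∂(σ (j + 1)).variation + (z - w) * resolvent σ z (d + 1) (j + 1) w) := by
      calc _ = ct (σ (j + 1)).variation (fun x => ∑ k ∈ Finset.Icc (j + 1) m,
            (-1) ^ k * reversedCauchy m σ z k * (dens σ (j + 1) k x : ℂ)) w := by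
            rw [haw.ct_sum]
            · refine Finset.sum_congr rfl fun k hk => ?_
              rw [Finset.mem_Icc] at hk
              rw [ct_const_mul, h.cauchy_eq_ct (by omega) (by omega) (by omega) hk.2]
            · intro k hk
              rw [Finset.mem_Icc] at hk
              exact ((h.hasMoments_dens (by omega) (by omega) (by omega) hk.2).const_mul
                _).integrable
        _ = (-1) ^ m * ct (σ (j + 1)).variation (fun x : ℝ => (z - x) *
            (sgn (σ (j + 1)) * resolvent σ z d (j + 1 + 1) x)) w := by
            rw [ct_congr hae, ct_const_mul]
        _ = _ := by
            congr 1
            -- The splitting is (z − x)/(w − x) = 1 + (z − w)/(w − x); the term 1 produces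
            -- ŝ_{m,j+1}(z), which cancels the leading term of the sum.
            rw [resolvent, ct, ct, ← integral_const_mul,
              ← integral_add hres ((haw.integrable_mul_inv hres).const_mul _)]
            refine integral_congr_ae ?_
            obtain ⟨δ, hδ, hA⟩ := haw
            filter_upwards [hA] with x hx
            have hne : w - (x : ℂ) ≠ 0 := by
              intro h0
              rw [h0, norm_zero] at hx
              linarith
            field_simp
            ring
    rw [hsum, h.integral_resolvent hz (show 1 ≤ j + 1 by omega) (by omega), reversedCauchy,
      if_neg (by omega)]
    have : (-1 : ℂ) ^ m * (-1) ^ d = -(-1) ^ j := by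
      rw [← pow_add, show m + d = 2 * d + (j + 1) by omega, pow_add, pow_mul]
      simp [pow_succ]
    linear_combination (cauchy (sMeas σ m (j + 1)) z) * this

/-- Subtract a_m(z) times the reversal identity at w = z. The term k = m drops out because its
reversed transform is 1. -/
lemma IsNikishin.levelForm_eq_reversed (h : IsNikishin m σ) {j : ℕ} (hj : j < m)
    (a : ℕ → ℂ[X]) {z : ℂ} (hz : z.im ≠ 0) :
    levelForm m σ a j z = (-1) ^ j * reversedForm m σ a j z +
      ∑ k ∈ Finset.Ico (j + 1) m, (-1) ^ k * reversedForm m σ a k z *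
        cauchy (sMeas σ (j + 1) k) z := by
  have h1 := h.sum_reversedCauchy hz (m - j) j (by omega) z (fun h0 => by omega)
    fun _ => away_of_im_ne_zero _ hz
  rw [sub_self, mul_zero, zero_mul] at h1
  have h2 : ∑ k ∈ Finset.Ico (j + 1) m, (-1) ^ k * reversedForm m σ a k z *
        cauchy (sMeas σ (j + 1) k) z = ∑ k ∈ Finset.Icc (j + 1) m, (-1) ^ k *
          ((a k).eval z - (a m).eval z * reversedCauchy m σ z k) *
            cauchy (sMeas σ (j + 1) k) z := by
    rw [← Finset.Ico_insert_right (show j + 1 ≤ m by omega), Finset.sum_insert (by simp)]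
    simp only [reversedCauchy, if_true, mul_one, sub_self, mul_zero, zero_mul, zero_add]
    refine Finset.sum_congr rfl fun k hk => ?_
    rw [Finset.mem_Ico] at hk
    rw [if_neg (by omega), reversedForm]
  have h3 : reversedForm m σ a j z = (a j).eval z - (a m).eval z * reversedCauchy m σ z j := by
    rw [reversedCauchy, if_neg (by omega), reversedForm]
  rw [h2, h3, levelForm]
  simp only [mul_sub, sub_mul, Finset.sum_sub_distrib]
  have h4 : ∑ k ∈ Finset.Icc (j + 1) m, (-1) ^ k * ((a m).eval z * reversedCauchy m σ z k) *
      cauchy (sMeas σ (j + 1) k) z = (a m).eval z * ∑ k ∈ Finset.Icc (j + 1) m,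
        (-1) ^ k * reversedCauchy m σ z k * cauchy (sMeas σ (j + 1) k) z := by
    rw [Finset.mul_sum]
    exact Finset.sum_congr rfl fun k _ => by ring
  rw [h4]
  linear_combination (a m).eval z * h1

lemma IsNikishin.levelPoly_eq_zero_iff (h : IsNikishin m σ) {j : ℕ} (hj : j < m)
    (a : ℕ → ℂ[X]) : levelPoly m σ a j = 0 ↔
      Tendsto (fun y => levelForm m σ a j (axis y)) atTop (𝓝 0) :=
  eq_zero_iff_tendsto_axis (h.hasMoments_levelDensity hj a).integrable
    fun _ hz => h.levelForm_eq hj a hz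

lemma IsNikishin.eq_polyPart_iff (h : IsNikishin m σ) {j : ℕ} (hj : j < m)
    (a : ℕ → ℂ[X]) : a j = polyPart (mom σ m (j + 1)) (a m) ↔
      Tendsto (fun y => reversedForm m σ a j (axis y)) atTop (𝓝 0) := by
  rw [← sub_eq_zero]
  exact eq_zero_iff_tendsto_axis (h.hasMoments_reversed hj a).integrable
    fun _ hz => h.reversedForm_eq hj a hz

/-- The polynomial parts of the forms `𝓐_l, …, 𝓐_{m-1}` vanish precisely when those of the
reversed forms do. -/
lemma IsNikishin.levelPoly_iff_reversed (h : IsNikishin m σ) (l : ℕ) (a : ℕ → ℂ[X]) :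
    (∀ j, l ≤ j → j < m → levelPoly m σ a j = 0) ↔
      ∀ j, l ≤ j → j < m → a j = polyPart (mom σ m (j + 1)) (a m) := by
  have hsum : ∀ j, j < m → (∀ k, j < k → k < m →
      a k = polyPart (mom σ m (k + 1)) (a m)) →
      Tendsto (fun y => ∑ k ∈ Finset.Ico (j + 1) m, (-1) ^ k * reversedForm m σ a k (axis y) *
        cauchy (sMeas σ (j + 1) k) (axis y)) atTop (𝓝 0) := by
    intro j hj hk
    rw [← Finset.sum_const_zero (s := Finset.Ico (j + 1) m)]
    refine tendsto_finsetSum _ fun k hk' => ?_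
    rw [Finset.mem_Ico] at hk'
    have h1 := ((h.eq_polyPart_iff hk'.2 a).1 (hk k (by omega) hk'.2)).const_mul ((-1 : ℂ) ^ k)
    have h2 := tendsto_ct_axis
      (h.hasMoments_dens (show 1 ≤ j + 1 by omega) (by omega) (show 1 ≤ k by omega)
        hk'.2.le).integrable
    have h3 := h1.mul h2
    simp only [mul_zero] at h3
    refine h3.congr fun y => ?_
    rw [h.cauchy_eq_ct (by omega) (by omega) (by omega) hk'.2.le]
  have heq : ∀ j, j < m → ∀ᶠ y in atTop, levelForm m σ a j (axis y) =
      (-1) ^ j * reversedForm m σ a j (axis y) + ∑ k ∈ Finset.Ico (j + 1) m,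
        (-1) ^ k * reversedForm m σ a k (axis y) * cauchy (sMeas σ (j + 1) k) (axis y) := by
    intro j hj
    filter_upwards [eventually_gt_atTop 0] with y hy
    exact h.levelForm_eq_reversed hj a (by rw [axis_im]; exact hy.ne')
  constructor
  · intro hA
    -- The system is triangular with diagonal entries ±1, so it is solved downwards from j = m − 1;
    -- d counts the levels above j.
    have key : ∀ d j, j + d + 1 = m → l ≤ j → a j = polyPart (mom σ m (j + 1)) (a m) := by
      intro d
      induction d using Nat.strong_induction_on with
      | _ d ih =>
        intro j hd hj
        have hjm : j < m := by omega
        rw [h.eq_polyPart_iff hjm]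
        have h1 := hsum j hjm fun k hk1 hk2 =>
          ih (m - 1 - k) (by omega) k (by omega) (by omega)
        have h2 := (h.levelPoly_eq_zero_iff hjm a).1 (hA j hj hjm)
        have h3 := (h2.sub h1).const_mul ((-1 : ℂ) ^ j)
        simp only [sub_zero, mul_zero] at h3
        refine h3.congr' ?_
        filter_upwards [heq j hjm] with y hy
        rw [hy, add_sub_cancel_right, ← mul_assoc, ← mul_pow]
        simp
    intro j hj hjm
    exact key (m - 1 - j) j (by omega) hj
  · intro hD j hj hjm
    rw [h.levelPoly_eq_zero_iff hjm]
    have h1 := hsum j hjm fun k hk1 hk2 => hD k (by omega) hk2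
    have h2 := ((h.eq_polyPart_iff hjm a).1 (hD j hj hjm)).const_mul ((-1 : ℂ) ^ j)
    have h3 := h2.add h1
    simp only [mul_zero, add_zero] at h3
    refine h3.congr' ?_
    filter_upwards [heq j hjm] with y hy
    rw [hy]

lemma IsNikishin.isDR_iff_isML (h : IsNikishin m σ) (n : ℕ) (a : ℕ → ℂ[X]) :
    IsDR m σ n a ↔ IsML m σ n a := by
  -- The condition on 𝓐_0 is common to both definitions, so only the levels from 1 on are compared.
  have key := h.levelPoly_iff_reversed 1 a
  constructor
  · intro ha
    refine ⟨ha.toIsAdmissible, ha.direct, fun j h1 h2 => (h.level_iff h2 a).2 ?_⟩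
    exact key.2 (fun j h1 h2 => (h.reversed_iff h2 a).1 (ha.reversed j h1 h2)) j h1 h2
  · intro ha
    refine ⟨ha.toIsAdmissible, ha.first, fun j h1 h2 => (h.reversed_iff h2 a).2 ?_⟩
    exact key.1 (fun j h1 h2 => (h.level_iff h2 a).1 (ha.level j h1 h2)) j h1 h2

end System

/-! ### Sign changes, orthogonality and zeros -/

lemma exists_sign_of_ne_zero {f : ℝ → ℝ} {I : Set ℝ} (hI : I.OrdConnected)
    (hf : ContinuousOn f I) (h : ∀ x ∈ I, f x ≠ 0) :
    ∃ η : ℝ, (η = 1 ∨ η = -1) ∧ ∀ x ∈ I, 0 < η * f x := by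
  by_cases hpos : ∀ x ∈ I, 0 < f x
  · exact ⟨1, Or.inl rfl, by simpa using hpos⟩
  · push Not at hpos
    obtain ⟨a, ha, hfa⟩ := hpos
    refine ⟨-1, Or.inr rfl, fun x hx => ?_⟩
    by_contra hx'
    have hfx : 0 ≤ f x := by linarith
    obtain ⟨y, hy, hy0⟩ := hI.isPreconnected.intermediate_value ha hx hf ⟨hfa, hfx⟩
    exact h y hy hy0

/-- A continuous function with finitely many zeros on an interval becomes of constant sign after
multiplication by the monic polynomial whose zeros are the sign changes. -/
lemma exists_finset_mul_prod_nonneg {f : ℝ → ℝ} (Z : Finset ℝ) :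
    ∀ {I : Set ℝ}, I.OrdConnected → ContinuousOn f I → (∀ x ∈ I, f x = 0 → x ∈ Z) →
    ∃ T ⊆ Z, ∃ η : ℝ, (η = 1 ∨ η = -1) ∧ ∀ x ∈ I, 0 ≤ η * (f x * ∏ t ∈ T, (x - t)) := by
  induction Z using Finset.induction_on_max with
  | empty =>
    intro I hI hf hZ
    obtain ⟨η, hη, h⟩ := exists_sign_of_ne_zero hI hf fun x hx h0 => by simpa using hZ x hx h0
    exact ⟨∅, le_rfl, η, hη, fun x hx => by simpa using (h x hx).le⟩
  | insert z Z hz ih =>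
    intro I hI hf hZ
    -- A point of I that is not a zero is discarded. Otherwise the induction treats the part of I
    -- left of z, the part to the right has no zeros, and z joins T exactly when the two signs
    -- disagree.
    by_cases hzI : z ∈ I ∧ f z ≠ 0
    · obtain ⟨T, hT, h⟩ := ih hI hf fun x hx h0 => by
        rcases Finset.mem_insert.1 (hZ x hx h0) with rfl | h1
        · exact absurd h0 hzI.2
        · exact h1
      exact ⟨T, hT.trans (Finset.subset_insert _ _), h⟩
    · obtain ⟨T, hT, η, hη, h⟩ := ih (hI.inter Set.ordConnected_Iio : (I ∩ Set.Iio z).OrdConnected)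
        (hf.mono Set.inter_subset_left) fun x hx h0 => by
          rcases Finset.mem_insert.1 (hZ x hx.1 h0) with rfl | h1
          · exact (lt_irrefl x (Set.mem_Iio.1 hx.2)).elim
          · exact h1
      obtain ⟨θ, hθ, h2⟩ := exists_sign_of_ne_zero
        (hI.inter Set.ordConnected_Ioi : (I ∩ Set.Ioi z).OrdConnected)
        (hf.mono Set.inter_subset_left) fun x hx h0 => by
          rcases Finset.mem_insert.1 (hZ x hx.1 h0) with rfl | h1
          · exact (lt_irrefl x (Set.mem_Ioi.1 hx.2)).elim
          · exact absurd (hz x h1) (not_lt.2 (le_of_lt hx.2))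
      have hprod : ∀ x, z < x → 0 < ∏ t ∈ T, (x - t) := fun x hx =>
        Finset.prod_pos fun t ht => by
          have := hz t (hT ht)
          linarith
      have hzT : z ∉ T := fun hzT => lt_irrefl _ (hz z (hT hzT))
      by_cases hηθ : η = θ
      · refine ⟨T, hT.trans (Finset.subset_insert _ _), η, hη, fun x hx => ?_⟩
        rcases lt_trichotomy x z with hxz | rfl | hxz
        · exact h x ⟨hx, hxz⟩
        · have : f x = 0 := by
            by_contra h0
            exact hzI ⟨hx, h0⟩
          simp [this]
        · rw [← mul_assoc, hηθ]
          exact (mul_pos (h2 x ⟨hx, hxz⟩) (hprod x hxz)).le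
      · have hθη : θ = -η := by
          rcases hη with rfl | rfl <;> rcases hθ with rfl | rfl <;> simp_all
        refine ⟨insert z T, Finset.insert_subset_insert _ hT, θ, hθ, fun x hx => ?_⟩
        rw [Finset.prod_insert hzT]
        rcases lt_trichotomy x z with hxz | rfl | hxz
        · have h3 := h x ⟨hx, hxz⟩
          have h4 : 0 ≤ z - x := by linarith
          calc 0 ≤ (η * (f x * ∏ t ∈ T, (x - t))) * (z - x) := mul_nonneg h3 h4
            _ = _ := by rw [hθη]; ring
        · simp
        · have h3 := mul_pos (h2 x ⟨hx, hxz⟩) (hprod x hxz)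
          have h4 : 0 ≤ x - z := by linarith
          calc 0 ≤ (θ * f x * ∏ t ∈ T, (x - t)) * (x - z) := mul_nonneg h3.le h4
            _ = _ := by ring

/-- Otherwise the open set in O where g ≠ 0 would be null and miss the support, leaving only
finitely many support points in O. -/
lemma infinite_nonzero_of_support {μ : Measure ℝ} {g : ℝ → ℝ} {O : Set ℝ}
    (hO : IsOpen O) (hsub : (μ.support ∩ O).Infinite) (hg : ContinuousOn g O)
    (hfin : {x ∈ O | g x = 0}.Finite) : ¬ ∀ᵐ x ∂μ, g x = 0 := by
  intro h
  have hV : IsOpen (O ∩ g ⁻¹' {0}ᶜ) := hg.isOpen_inter_preimage hO isOpen_compl_singleton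
  have hV0 : μ (O ∩ g ⁻¹' {0}ᶜ) = 0 := measure_mono_null (fun x hx => hx.2) h
  refine hsub (hfin.subset ?_)
  rintro x ⟨hx, hxO⟩
  refine ⟨hxO, ?_⟩
  by_contra h0
  have := (Measure.mem_support_iff_forall x).1 hx _ (hV.mem_nhds ⟨hxO, h0⟩)
  exact this.ne' hV0

/-- A continuous function that is orthogonal to all polynomials of degree less than `n`, with
respect to a measure of constant sign, has at least `n` zeros in the interior of the convex hull
of the support. -/
lemma exists_zeros_of_orthogonal {μ : Measure ℝ} (hμ : μ.support.Infinite) {U : Set ℝ}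
    (hU : IsOpen U) (haeU : ∀ᵐ x ∂μ, x ∈ U) (hIU : interior (convexHull ℝ μ.support) ⊆ U)
    {f w : ℝ → ℝ} (hf : ContinuousOn f U) {θ : ℝ} (hw : ∀ᵐ x ∂μ, 0 < θ * w x)
    {n : ℕ} (ho : ∀ r : ℝ[X], r.degree < n → Integrable (fun x => f x * r.eval x * w x) μ ∧
      ∫ x, f x * r.eval x * w x ∂μ = 0) :
    ∃ S : Finset ℝ, S.card = n ∧ (∀ s ∈ S, s ∈ interior (convexHull ℝ μ.support)) ∧
      ∀ s ∈ S, f s = 0 := by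
  set O := interior (convexHull ℝ μ.support) with hO
  have hOo : IsOpen O := isOpen_interior
  have hOc : O.OrdConnected := (convex_convexHull ℝ μ.support).interior.ordConnected
  by_cases hfin : {x ∈ O | f x = 0}.Finite
  · by_cases hcard : n ≤ hfin.toFinset.card
    · obtain ⟨S, hS, hc⟩ := Finset.exists_subset_card_eq hcard
      refine ⟨S, hc, fun s hs => ?_, fun s hs => ?_⟩
      · exact ((Set.Finite.mem_toFinset hfin).1 (hS hs)).1
      · exact ((Set.Finite.mem_toFinset hfin).1 (hS hs)).2
    · exfalso
      push Not at hcard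
      obtain ⟨T, hT, η, hη, hpos⟩ := exists_finset_mul_prod_nonneg hfin.toFinset hOc
        (hf.mono hIU) fun x hx h0 => (Set.Finite.mem_toFinset hfin).2 ⟨hx, h0⟩
      -- With fewer than n zeros, this polynomial cancels all sign changes of f and is still an
      -- admissible test polynomial.
      set r : ℝ[X] := ∏ t ∈ T, (X - C t) with hr
      have hre : ∀ x, r.eval x = ∏ t ∈ T, (x - t) := fun x => by simp [hr, eval_prod]
      have hrd : r.degree < n := by
        rw [hr, degree_prod]
        simp only [degree_X_sub_C, Finset.sum_const, nsmul_one]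
        exact_mod_cast (Finset.card_le_card hT).trans_lt hcard
      obtain ⟨hint, hzero⟩ := ho r hrd
      -- The sign is known only inside the hull; continuity on U carries it to an endpoint of the
      -- hull, which may have positive mass.
      have hcl : ∀ x ∈ μ.support, x ∈ U → 0 ≤ η * (f x * r.eval x) := by
        intro x hx hxU
        have h1 : x ∈ closure (O ∩ U) :=
          hU.closure_inter ⟨subset_closure_interior_convexHull hμ hx, hxU⟩
        have hc : ContinuousAt (fun y => η * (f y * r.eval y)) x :=
          continuousAt_const.mul ((hf.continuousAt (hU.mem_nhds hxU)).mul
            r.continuous.continuousAt)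
        have h2 := hc.continuousWithinAt.mem_closure (t := Set.Ici 0) h1
          fun y hy => by
            simp only [Set.mem_Ici, hre]
            exact hpos y hy.1
        simpa using h2
      have haes : ∀ᵐ x ∂μ, x ∈ μ.support := Measure.support_mem_ae
      have hnn : ∀ᵐ x ∂μ, 0 ≤ η * θ * (f x * r.eval x * w x) := by
        filter_upwards [haes, haeU, hw] with x h1 h2 h3
        have := mul_nonneg (hcl x h1 h2) h3.le
        calc 0 ≤ _ := this
          _ = _ := by ring
      have h0 : ∫ x, η * θ * (f x * r.eval x * w x) ∂μ = 0 := by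
        rw [integral_const_mul, hzero, mul_zero]
      rw [integral_eq_zero_iff_of_nonneg_ae hnn (hint.const_mul _)] at h0
      have hz : ∀ᵐ x ∂μ, f x * r.eval x = 0 := by
        filter_upwards [h0, hw] with x h1 h2
        have hη0 : η ≠ 0 := by rcases hη with rfl | rfl <;> norm_num
        have hθ0 : θ ≠ 0 := fun h => by simp [h] at h2
        have hw0 : w x ≠ 0 := fun h => by simp [h] at h2
        simp only [Pi.zero_apply, mul_eq_zero, hη0, hθ0, hw0, or_false, false_or] at h1
        exact mul_eq_zero.2 h1
      refine infinite_nonzero_of_support hOo (infinite_inter_interior_convexHull hμ)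
        ((hf.mono hIU).mul r.continuous.continuousOn) ?_ hz
      refine (hfin.union T.finite_toSet).subset ?_
      rintro x ⟨hxO, hx⟩
      rcases mul_eq_zero.1 hx with h | h
      · exact Or.inl ⟨hxO, h⟩
      · simp only [hre, Finset.prod_eq_zero_iff] at h
        obtain ⟨t, ht, hxt⟩ := h
        right
        rw [sub_eq_zero.1 hxt]
        exact ht
  · obtain ⟨S, hS, hc⟩ := Set.Infinite.exists_subset_card_eq hfin n
    exact ⟨S, hc, fun s hs => (hS hs).1, fun s hs => (hS hs).2⟩

/-- Since deg r < |S|, the quotient of r by the product over S is a combination of the simple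
fractions 1/(y − s), and g is orthogonal to each of them. -/
lemma integral_mul_eval_div_prod_eq_zero {μ : Measure ℝ} {g : ℝ → ℝ} (hg : Integrable g μ)
    {S : Finset ℝ} (haw : ∀ s ∈ S, Away μ (s : ℂ)) (hz : ∀ s ∈ S, ∫ y, g y * (s - y)⁻¹ ∂μ = 0)
    {r : ℝ[X]} (hr : r.degree < S.card) :
    Integrable (fun y => g y * r.eval y * (∏ s ∈ S, (y - s))⁻¹) μ ∧
      ∫ y, g y * r.eval y * (∏ s ∈ S, (y - s))⁻¹ ∂μ = 0 := by
  have hne : ∀ᵐ y ∂μ, ∀ s ∈ S, y ≠ s := by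
    rw [Filter.eventually_all_finset]
    intro s hs
    obtain ⟨δ, hδ, h⟩ := haw s hs
    filter_upwards [h] with y hy hys
    rw [hys, sub_self, norm_zero] at hy
    linarith
  have hae : (fun y => ∑ s ∈ S, (-(Lagrange.nodalWeight S id s * r.eval s)) * (g y * (s - y)⁻¹))
      =ᵐ[μ] fun y => g y * r.eval y * (∏ s ∈ S, (y - s))⁻¹ := by
    filter_upwards [hne] with y hy
    have h1 : r = Lagrange.interpolate S id fun i => r.eval i :=
      Lagrange.eq_interpolate (Set.injOn_id _) hr
    have h2 : r.eval y = (Lagrange.nodal S id).eval y *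
        ∑ s ∈ S, Lagrange.nodalWeight S id s * (y - s)⁻¹ * r.eval s := by
      conv_lhs => rw [h1]
      exact Lagrange.eval_interpolate_not_at_node _ hy
    have h3 : (Lagrange.nodal S id).eval y = ∏ s ∈ S, (y - s) := Lagrange.eval_nodal
    have h4 : ∏ s ∈ S, (y - s) ≠ 0 := Finset.prod_ne_zero_iff.2 fun s hs => sub_ne_zero.2 (hy s hs)
    rw [h2, h3]
    have h5 : g y * ((∏ s ∈ S, (y - s)) * ∑ s ∈ S, Lagrange.nodalWeight S id s * (y - s)⁻¹ *
        r.eval s) * (∏ s ∈ S, (y - s))⁻¹ =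
        g y * ∑ s ∈ S, Lagrange.nodalWeight S id s * (y - s)⁻¹ * r.eval s := by
      field_simp
    rw [h5, Finset.mul_sum]
    refine Finset.sum_congr rfl fun s hs => ?_
    rw [← neg_sub y s, inv_neg]
    ring
  have hint : ∀ s ∈ S, Integrable (fun y =>
      (-(Lagrange.nodalWeight S id s * r.eval s)) * (g y * (s - y)⁻¹)) μ :=
    fun s hs => ((haw s hs).integrable_mul_inv_real hg).const_mul _
  refine ⟨(integrable_finsetSum S hint).congr hae, ?_⟩
  rw [← integral_congr_ae hae, integral_finsetSum S hint]
  refine Finset.sum_eq_zero fun s hs => ?_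
  rw [integral_const_mul, hz s hs, mul_zero]

lemma interior_convexHull_subset_side {μ : Measure ℝ} {c s : ℝ} (hs : s = 1 ∨ s = -1)
    (h : ∀ᵐ x ∂μ, s * (x - c) < 0) {x : ℝ} (hx : x ∈ interior (convexHull ℝ μ.support)) :
    s * (x - c) < 0 := by
  rcases hs with rfl | rfl
  · have h1 : μ.support ⊆ Set.Iic c := Measure.support_subset_of_isClosed isClosed_Iic (by
      filter_upwards [h] with x hx
      rw [Set.mem_Iic]
      linarith)
    have h2 := interior_mono (convexHull_min h1 (convex_Iic c)) hx
    rw [interior_Iic, Set.mem_Iio] at h2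
    linarith
  · have h1 : μ.support ⊆ Set.Ici c := Measure.support_subset_of_isClosed isClosed_Ici (by
      filter_upwards [h] with x hx
      rw [Set.mem_Ici]
      linarith)
    have h2 := interior_mono (convexHull_min h1 (convex_Ici c)) hx
    rw [interior_Ici, Set.mem_Ioi] at h2
    linarith

lemma continuousOn_ct_side {μ : Measure ℝ} {c s : ℝ} (hs : s = 1 ∨ s = -1)
    (h : ∀ᵐ y ∂μ, 0 < s * (y - c)) {G : ℝ → ℂ} (hG : Integrable G μ) :
    ContinuousOn (fun x : ℝ => ct μ G x) {x | s * (x - c) < 0} := by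
  intro x₀ hx₀
  have hU : IsOpen {x : ℝ | s * (x - c) < 0} := isOpen_lt (by fun_prop) continuous_const
  have hpos : 0 < |x₀ - c| := by
    rw [abs_pos]
    intro h0
    simp [h0] at hx₀
  have hev : ∀ᶠ x in 𝓝 x₀, s * (x - c) < 0 ∧ |x₀ - c| / 2 < |x - c| := by
    have h0 : ∀ᶠ x in 𝓝 x₀, s * (x - c) < 0 := hU.mem_nhds hx₀
    refine h0.and ?_
    have : ContinuousAt (fun x : ℝ => |x - c|) x₀ := by fun_prop
    exact this.eventually (lt_mem_nhds (by linarith))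
  refine (continuousAt_of_dominated (bound := fun y => ‖G y‖ * (|x₀ - c| / 2)⁻¹) ?_ ?_
    (hG.norm.mul_const _) ?_).continuousWithinAt
  · exact Eventually.of_forall fun x => hG.aestronglyMeasurable.mul
      (Measurable.aestronglyMeasurable (by fun_prop))
  · filter_upwards [hev] with x hx
    filter_upwards [h] with y hy
    have h3 := (sub_bounds_of_sides hs hx.1 hy).2.1
    rw [norm_mul, norm_inv, ← Complex.ofReal_sub, Complex.norm_real, Real.norm_eq_abs]
    gcongr
    linarith
  · filter_upwards [h] with y hy
    have h3 := (sub_bounds_of_sides hs hx₀ hy).2.1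
    have hne : (x₀ : ℂ) - (y : ℂ) ≠ 0 := by
      rw [← Complex.ofReal_sub, Complex.ofReal_ne_zero]
      intro h0
      rw [h0, abs_zero] at h3
      linarith
    have : ContinuousAt (fun x : ℝ => (x : ℂ) - (y : ℂ)) x₀ := by fun_prop
    exact continuousAt_const.mul (this.inv₀ hne)

/-! ### Descent of orthogonality through the levels -/

section System

variable {m : ℕ} {σ : ℕ → SignedMeasure ℝ}

/-- `Re 𝓐_j` is orthogonal to the polynomials of degree less than `n` with respect to the
measure `dσ_j / ∏ (x - s)`, where the product over `S` has constant sign on the interior of `Δ_j`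
and almost everywhere. -/
structure IsOrthogonal (m : ℕ) (σ : ℕ → SignedMeasure ℝ) (n : ℕ) (a : ℕ → ℂ[X]) (j : ℕ)
    (S : Finset ℝ) : Prop where
  card : S.card ≤ n
  sign : ∃ η : ℝ, (η = 1 ∨ η = -1) ∧ (∀ᵐ y ∂(σ j).variation, 0 < η * ∏ s ∈ S, (y - s)) ∧
    ∀ y ∈ interior (hull σ j), 0 < η * ∏ s ∈ S, (y - s)
  orth : ∀ r : ℝ[X], r.degree < n →
    Integrable (fun y : ℝ => (levelForm m σ a j y).re * r.eval y * (∏ s ∈ S, (y - s))⁻¹)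
      (σ j).variation ∧
    ∫ y : ℝ, (levelForm m σ a j y).re * r.eval y * (∏ s ∈ S, (y - s))⁻¹ ∂(σ j).variation = 0

lemma IsNikishin.sgn_ne_zero (h : IsNikishin m σ) {j : ℕ} (h1 : 1 ≤ j) (h2 : j ≤ m) :
    sgn (σ j) ≠ 0 := by
  rcases (h.sgn_spec h1 h2).1 with e | e <;> simp [e]

lemma IsNikishin.sgn_mul_self (h : IsNikishin m σ) {j : ℕ} (h1 : 1 ≤ j) (h2 : j ≤ m) :
    sgn (σ j) * sgn (σ j) = 1 := by
  rcases (h.sgn_spec h1 h2).1 with e | e <;> simp [e]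

lemma IsNikishin.integrable_levelForm_re (h : IsNikishin m σ) {j : ℕ} (hj : j < m) (a : ℕ → ℂ[X])
    (r : ℂ[X]) : Integrable (fun y : ℝ => (r.eval (y : ℂ) * levelForm m σ a (j + 1) y).re)
      (σ (j + 1)).variation := by
  have := (((h.hasMoments_levelDensity hj a).eval_mul r).const_mul
    (sgn (σ (j + 1)) : ℂ)).integrable.re
  refine this.congr (Eventually.of_forall fun x => ?_)
  have h2 : (sgn (σ (j + 1)) : ℂ) * sgn (σ (j + 1)) = 1 := by
    rw [← Complex.ofReal_mul, h.sgn_mul_self (by omega) hj, Complex.ofReal_one]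
  simp only [levelDensity, RCLike.re_to_complex]
  congr 1
  linear_combination (r.eval (x : ℂ) * levelForm m σ a (j + 1) x) * h2

lemma eval_map_ofReal (r : ℝ[X]) (x : ℝ) :
    (r.map Complex.ofRealHom).eval (x : ℂ) = ((r.eval x : ℝ) : ℂ) := by
  rw [eval_map, ← Complex.ofRealHom_eq_coe x, eval₂_at_apply]
  rfl

lemma IsSolution.isOrthogonal_one (h : IsNikishin m σ) (hm : 1 ≤ m) {n : ℕ} {a : ℕ → ℂ[X]}
    (ha : IsSolution m σ n a) : IsOrthogonal m σ n a 1 ∅ where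
  card := by simp
  sign := ⟨1, Or.inl rfl, by simp, by simp⟩
  orth := by
    intro r hr
    have h1 := h.integrable_levelForm_re (show 0 < m by omega) a (r.map Complex.ofRealHom)
    have e : ∀ y : ℝ, (levelForm m σ a 1 y).re * r.eval y * (∏ s ∈ (∅ : Finset ℝ), (y - s))⁻¹ =
        ((r.map Complex.ofRealHom).eval (y : ℂ) * levelForm m σ a 1 y).re := by
      intro y
      rw [eval_map_ofReal, Complex.re_ofReal_mul]
      simp [mul_comm]
    simp only [e]
    refine ⟨h1, ?_⟩
    have hmom := h.hasMoments_levelDensity (show 0 < m by omega) a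
    have h2 : ∫ y : ℝ, (r.map Complex.ofRealHom).eval (y : ℂ) * levelDensity m σ a 1 y
        ∂(σ 1).variation = 0 := by
      rw [← momentFunctional_eq_integral hmom]
      rw [momentFunctional, lsum_apply, Polynomial.sum]
      refine Finset.sum_eq_zero fun i hi => ?_
      have h3 : i < n := by
        have h4 := (le_degree_of_mem_supp i hi).trans_lt (degree_map_le.trans_lt hr)
        exact_mod_cast h4
      have h5 := ha.orth i h3
      simp only [zero_add] at h5 ⊢
      rw [h5]
      simp
    have h3 : ∫ y : ℝ, (r.map Complex.ofRealHom).eval (y : ℂ) * levelForm m σ a 1 y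
        ∂(σ 1).variation = 0 := by
      have h4 : ∀ y : ℝ, (r.map Complex.ofRealHom).eval (y : ℂ) * levelDensity m σ a 1 y =
          (sgn (σ 1) : ℂ) * ((r.map Complex.ofRealHom).eval (y : ℂ) * levelForm m σ a 1 y) := by
        intro y
        rw [levelDensity]
        ring
      simp only [h4] at h2
      rw [integral_const_mul, mul_eq_zero] at h2
      exact h2.resolve_left (Complex.ofReal_ne_zero.2 (h.sgn_ne_zero le_rfl hm))
    have hint : Integrable (fun y : ℝ => (r.map Complex.ofRealHom).eval (y : ℂ) *
        levelForm m σ a 1 y) (σ 1).variation := by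
      refine ((hmom.eval_mul (r.map Complex.ofRealHom)).const_mul
        (sgn (σ 1) : ℂ)).integrable.congr (Eventually.of_forall fun x => ?_)
      have h2 : (sgn (σ 1) : ℂ) * sgn (σ 1) = 1 := by
        rw [← Complex.ofReal_mul, h.sgn_mul_self le_rfl hm, Complex.ofReal_one]
      simp only [levelDensity, zero_add]
      linear_combination ((r.map Complex.ofRealHom).eval (x : ℂ) * levelForm m σ a 1 x) * h2
    have h5 := integral_re hint
    rw [h3] at h5
    simpa using h5

lemma IsSolution.levelForm_eq_ct (h : IsNikishin m σ) {n : ℕ} {a : ℕ → ℂ[X]}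
    (ha : IsSolution m σ n a) {j : ℕ} (hj : j < m) {z : ℂ} (hz : Away (σ (j + 1)).variation z) :
    levelForm m σ a j z = ct (σ (j + 1)).variation (levelDensity m σ a (j + 1)) z := by
  rw [h.levelForm_eq hj a hz, ha.poly j hj, eval_zero, zero_add]

/-- Re 𝓐_j has n zeros inside Δ_j, at positive distance from a carrier of σ_{j+1}. There it is the
transform of Re 𝓐_{j+1} dσ_{j+1}, so Re 𝓐_{j+1} is orthogonal to the n fractions 1/(t − y), hence to
r over the product of the y − t for deg r < n. Real parts pass through because the measures are
real. -/
lemma IsOrthogonal.succ (h : IsNikishin m σ) {n : ℕ} {a : ℕ → ℂ[X]} (ha : IsSolution m σ n a)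
    {j : ℕ} (h1 : 1 ≤ j) (hj : j < m) {S : Finset ℝ} (hS : IsOrthogonal m σ n a j S) :
    ∃ S', IsOrthogonal m σ n a (j + 1) S' := by
  obtain ⟨c, s, hs, hc1, hc2⟩ := h.separated h1 hj
  obtain ⟨η, hη, hη1, -⟩ := hS.sign
  have hcont : ContinuousOn (fun x : ℝ => (levelForm m σ a j x).re) {x | s * (x - c) < 0} := by
    have := continuousOn_ct_side hs hc2 (h.hasMoments_levelDensity hj a).integrable
    refine (Complex.continuous_re.comp_continuousOn this).congr fun x hx => ?_
    simp only [Function.comp]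
    rw [ha.levelForm_eq_ct h hj (away_of_side hs hc2 hx)]
  obtain ⟨Z, hZc, hZi, hZ0⟩ := exists_zeros_of_orthogonal (h.mem j h1 hj.le).infinite_supp
    (isOpen_lt (by fun_prop) continuous_const : IsOpen {x : ℝ | s * (x - c) < 0}) hc1
    (fun x hx => interior_convexHull_subset_side hs hc1 hx) hcont
    (w := fun y => (∏ s ∈ S, (y - s))⁻¹) (θ := η) (by
      filter_upwards [hη1] with y hy
      have : η * (∏ s ∈ S, (y - s))⁻¹ = (η * ∏ s ∈ S, (y - s))⁻¹ := by
        rw [mul_inv]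
        rcases hη with rfl | rfl <;> norm_num
      rw [this]
      exact inv_pos.2 hy) hS.orth
  have hside : ∀ t ∈ Z, s * (t - c) < 0 := fun t ht =>
    interior_convexHull_subset_side hs hc1 (hZi t ht)
  have hprod : ∀ y, 0 < s * (y - c) → 0 < s ^ Z.card * ∏ t ∈ Z, (y - t) := by
    intro y hy
    rw [← Finset.prod_const, ← Finset.prod_mul_distrib]
    refine Finset.prod_pos fun t ht => ?_
    have := (sub_bounds_of_sides hs (hside t ht) hy).1
    linarith
  -- Each factor y − t has the sign s, whence the sign `s ^ Z.card` of the product.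
  refine ⟨Z, hZc.le, ⟨s ^ Z.card, ?_, ?_, ?_⟩, ?_⟩
  · rcases hs with rfl | rfl
    · simp
    · exact neg_one_pow_eq_or ℝ _
  · filter_upwards [hc2] with y hy
    exact hprod y hy
  · intro y hy
    refine hprod y ?_
    have := interior_convexHull_subset_side (μ := (σ (j + 1)).variation) (c := c) (s := -s)
      (by rcases hs with rfl | rfl <;> simp) (by
        filter_upwards [hc2] with x hx
        linarith) hy
    linarith
  · intro r hr
    have hg : Integrable (fun y : ℝ => (levelForm m σ a (j + 1) y).re) (σ (j + 1)).variation := by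
      simpa using h.integrable_levelForm_re hj a 1
    have haw : ∀ t ∈ Z, Away (σ (j + 1)).variation (t : ℂ) := fun t ht =>
      away_of_side hs hc2 (hside t ht)
    refine integral_mul_eval_div_prod_eq_zero hg haw ?_ (by rw [hZc]; exact hr)
    intro t ht
    have h2 := hZ0 t ht
    rw [ha.levelForm_eq_ct h hj (haw t ht), ct, ← RCLike.re_to_complex, ← integral_re
      ((haw t ht).integrable_mul_inv (h.hasMoments_levelDensity hj a).integrable)] at h2
    have h3 : ∀ y : ℝ, RCLike.re (levelDensity m σ a (j + 1) y * ((t : ℂ) - (y : ℂ))⁻¹) =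
        sgn (σ (j + 1)) * ((levelForm m σ a (j + 1) y).re * (t - y)⁻¹) := by
      intro y
      rw [levelDensity, ← Complex.ofReal_sub, ← Complex.ofReal_inv, mul_comm, RCLike.re_to_complex,
        Complex.re_ofReal_mul, Complex.re_ofReal_mul]
      ring
    simp only [h3] at h2
    rw [integral_const_mul, mul_eq_zero] at h2
    exact h2.resolve_left (h.sgn_ne_zero (by omega) hj)

lemma IsSolution.exists_isOrthogonal (h : IsNikishin m σ) {n : ℕ} {a : ℕ → ℂ[X]}
    (ha : IsSolution m σ n a) {j : ℕ} (h1 : 1 ≤ j) (hj : j ≤ m) :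
    ∃ S, IsOrthogonal m σ n a j S := by
  induction j, h1 using Nat.le_induction with
  | base => exact ⟨∅, ha.isOrthogonal_one h hj⟩
  | succ j h1 ih =>
    obtain ⟨S, hS⟩ := ih (by omega)
    exact hS.succ h ha h1 hj

lemma IsSolution.exists_zeros (h : IsNikishin m σ) (hm : 1 ≤ m) {n : ℕ} {a : ℕ → ℂ[X]}
    (ha : IsSolution m σ n a) : ∃ S : Finset ℝ, S.card = n ∧ (∀ s ∈ S, s ∈ interior (hull σ m)) ∧
      ∀ s ∈ S, ((a m).eval (s : ℂ)).re = 0 := by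
  obtain ⟨S, hS⟩ := ha.exists_isOrthogonal h hm le_rfl
  obtain ⟨η, hη, hη1, -⟩ := hS.sign
  have e : ∀ x : ℝ, (levelForm m σ a m x).re = (-1) ^ m * ((a m).eval (x : ℂ)).re := by
    intro x
    rw [levelForm_last, show (-1 : ℂ) ^ m = (((-1 : ℝ) ^ m : ℝ) : ℂ) by push_cast; rfl,
      Complex.re_ofReal_mul]
  obtain ⟨Z, hZc, hZi, hZ0⟩ := exists_zeros_of_orthogonal (h.mem m hm le_rfl).infinite_supp
    isOpen_univ (by simp) (Set.subset_univ _) (f := fun x : ℝ => (levelForm m σ a m x).re) (by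
      simp only [e]
      have : Continuous fun x : ℝ => (a m).eval (x : ℂ) :=
        (a m).continuous.comp Complex.continuous_ofReal
      fun_prop)
    (w := fun y => (∏ s ∈ S, (y - s))⁻¹) (θ := η) (by
      filter_upwards [hη1] with y hy
      have : η * (∏ s ∈ S, (y - s))⁻¹ = (η * ∏ s ∈ S, (y - s))⁻¹ := by
        rw [mul_inv]
        rcases hη with rfl | rfl <;> norm_num
      rw [this]
      exact inv_pos.2 hy) hS.orth
  refine ⟨Z, hZc, hZi, fun s hs => ?_⟩
  have := hZ0 s hs
  simp only [e] at this
  rcases mul_eq_zero.1 this with h0 | h0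
  · exact absurd h0 (pow_ne_zero _ (by norm_num))
  · exact h0

end System

/-! ### Polynomials determined by their real zeros -/

/-- The polynomial whose coefficients are the real parts of those of `p`. -/
def rePoly (p : ℂ[X]) : ℝ[X] :=
  ∑ i ∈ Finset.range (p.natDegree + 1), monomial i (p.coeff i).re

lemma coeff_rePoly (p : ℂ[X]) (i : ℕ) : (rePoly p).coeff i = (p.coeff i).re := by
  rw [rePoly, finsetSum_coeff]
  simp only [coeff_monomial, Finset.sum_ite_eq', Finset.mem_range]
  split_ifs with h
  · rfl
  · rw [coeff_eq_zero_of_natDegree_lt (by omega), Complex.zero_re]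

lemma eval_rePoly (p : ℂ[X]) (x : ℝ) : (rePoly p).eval x = (p.eval (x : ℂ)).re := by
  rw [rePoly, eval_finsetSum, eval_eq_sum_range, Complex.re_sum]
  refine Finset.sum_congr rfl fun i _ => ?_
  rw [eval_monomial, ← Complex.ofReal_pow, mul_comm (p.coeff i), Complex.re_ofReal_mul, mul_comm]

lemma re_coeff_eq_zero {p : ℂ[X]} {S : Finset ℝ} (hd : ∀ i, S.card ≤ i → (p.coeff i).re = 0)
    (h0 : ∀ s ∈ S, (p.eval (s : ℂ)).re = 0) (i : ℕ) : (p.coeff i).re = 0 := by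
  have : rePoly p = 0 := by
    refine eq_zero_of_degree_lt_of_eval_finset_eq_zero S ?_ fun s hs => ?_
    · rw [degree_lt_iff_coeff_zero]
      intro i hi
      rw [coeff_rePoly, hd i hi]
    · rw [eval_rePoly, h0 s hs]
  rw [← coeff_rePoly, this, coeff_zero]

lemma map_rePoly {p : ℂ[X]} (h : ∀ i, (p.coeff i).im = 0) :
    (rePoly p).map Complex.ofRealHom = p := by
  ext i
  rw [coeff_map, coeff_rePoly]
  exact Complex.ext rfl (h i).symm

lemma eq_prod_of_monic {P : ℝ[X]} {T : Finset ℝ} (hP : P.Monic) (hd : P.natDegree = T.card)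
    (h0 : ∀ t ∈ T, P.eval t = 0) : P = ∏ t ∈ T, (X - C t) := by
  have hle : T.val ≤ P.roots := by
    rw [Multiset.le_iff_subset T.nodup]
    intro t ht
    rw [mem_roots hP.ne_zero]
    exact h0 t ht
  have hr : T.val = P.roots :=
    Multiset.eq_of_le_of_card_le hle ((card_roots' P).trans hd.le)
  have := prod_multiset_X_sub_C_of_monic_of_roots_card_eq hP (by rw [← hr, hd]; rfl)
  rw [← this, ← hr]
  rfl

lemma zerosSimpleInInterior_of_eval_eq_zero {q : ℂ[X]} {Δ : Set ℝ} {T : Finset ℝ} (hq : q ≠ 0)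
    (hd : q.natDegree ≤ T.card) (hT : ∀ t ∈ T, t ∈ interior Δ)
    (h0 : ∀ t ∈ T, q.eval (t : ℂ) = 0) : ZerosSimpleInInterior q Δ := by
  have hnd : (T.val.map ((↑) : ℝ → ℂ)).Nodup := T.nodup.map Complex.ofReal_injective
  have hle : T.val.map ((↑) : ℝ → ℂ) ≤ q.roots := by
    rw [Multiset.le_iff_subset hnd]
    intro z hz
    obtain ⟨t, ht, rfl⟩ := Multiset.mem_map.1 hz
    rw [mem_roots hq]
    exact h0 t ht
  have hr : T.val.map ((↑) : ℝ → ℂ) = q.roots :=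
    Multiset.eq_of_le_of_card_le hle (by
      rw [Multiset.card_map]
      exact (card_roots' q).trans hd)
  intro z hz
  have hz' : z ∈ T.val.map ((↑) : ℝ → ℂ) := by
    rw [hr, mem_roots hq]
    exact hz
  refine ⟨?_, ?_⟩
  · rw [← count_roots, ← hr]
    exact Multiset.count_eq_one_of_mem hnd hz'
  · obtain ⟨t, ht, rfl⟩ := Multiset.mem_map.1 hz'
    exact ⟨t, hT t ht, rfl⟩

/-! ### Interlacing and Gaussian quadrature weights -/

lemma sum_eval_div_prod_eq_zero {T : Finset ℝ} {r : ℝ[X]} (hr : r.degree < (T.card - 1 : ℕ)) :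
    ∑ y ∈ T, r.eval y / ∏ s ∈ T.erase y, (y - s) = 0 := by
  have h1 : r.degree < T.card := hr.trans_le (by exact_mod_cast Nat.sub_le _ _)
  -- The sum is the coefficient of X^{|T|−1} in the Lagrange interpolant of r, which is r itself.
  have h2 := Lagrange.coeff_eq_sum (Set.injOn_id (T : Set ℝ)) h1
  rw [coeff_eq_zero_of_degree_lt hr] at h2
  exact h2.symm

/-- A polynomial whose values on `T` have the alternating signs of the derivative of
`∏ (x - t)` has a zero between any two points of `T`. -/
lemma exists_zeros_of_interlacing {O : Set ℝ} (hO : O.OrdConnected) {T : Finset ℝ}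
    (hne : T.Nonempty) (hT : ∀ t ∈ T, t ∈ O) {R : ℝ[X]} {c : ℝ}
    (hR : ∀ y ∈ T, 0 < c * (R.eval y * ∏ s ∈ T.erase y, (y - s))) :
    ∃ Z : Finset ℝ, Z.card = T.card - 1 ∧ (∀ z ∈ Z, z ∈ O) ∧ ∀ z ∈ Z, R.eval z = 0 := by
  classical
  have hR0 : R ≠ 0 := by
    rintro rfl
    obtain ⟨t, ht⟩ := hne
    simpa using hR t ht
  set Z := R.roots.toFinset.filter (· ∈ O) with hZ
  have hmem : ∀ x, x ∈ Z ↔ R.eval x = 0 ∧ x ∈ O := fun x => by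
    simp [hZ, hR0]
  by_cases hcard : T.card - 1 ≤ Z.card
  · obtain ⟨W, hW, hc⟩ := Finset.exists_subset_card_eq hcard
    exact ⟨W, hc, fun z hz => ((hmem z).1 (hW hz)).2, fun z hz => ((hmem z).1 (hW hz)).1⟩
  · exfalso
    push Not at hcard
    obtain ⟨W, hW, η, hη, hpos⟩ := exists_finset_mul_prod_nonneg Z hO R.continuous.continuousOn
      fun x hx h0 => (hmem x).2 ⟨h0, hx⟩
    set r : ℝ[X] := ∏ t ∈ W, (X - C t) with hr
    have hre : ∀ x, r.eval x = ∏ t ∈ W, (x - t) := fun x => by simp [hr, eval_prod]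
    have hrd : r.degree = W.card := by
      rw [hr, degree_prod]
      simp
    have hW' : W.card < T.card - 1 := (Finset.card_le_card hW).trans_lt hcard
    -- If R had too few zeros, r cancelling its sign changes would have degree below |T| − 1. All
    -- terms r(y)/∏(y − s) would then share one sign and sum to 0, so r would vanish on T, which its
    -- degree forbids.
    have hsum := sum_eval_div_prod_eq_zero (T := T) (r := r) (by
      rw [hrd]
      exact_mod_cast hW')
    have hsum' : ∑ y ∈ T, η * c * (r.eval y / ∏ s ∈ T.erase y, (y - s)) = 0 := by
      rw [← Finset.mul_sum, hsum, mul_zero]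
    have hterm : ∀ y ∈ T, 0 ≤ η * c * (r.eval y / ∏ s ∈ T.erase y, (y - s)) := by
      intro y hy
      have h1 := hpos y (hT y hy)
      rw [← hre] at h1
      have h2 := hR y hy
      have h3 : R.eval y ≠ 0 := fun h => by simp [h] at h2
      have h4 : ∏ s ∈ T.erase y, (y - s) ≠ 0 := fun h => by simp [h] at h2
      have h5 : 0 < (R.eval y * ∏ s ∈ T.erase y, (y - s)) ^ 2 := by positivity
      have h6 : η * c * (r.eval y / ∏ s ∈ T.erase y, (y - s)) =
          η * (R.eval y * r.eval y) * (c * (R.eval y * ∏ s ∈ T.erase y, (y - s))) /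
            (R.eval y * ∏ s ∈ T.erase y, (y - s)) ^ 2 := by
        field_simp
      rw [h6]
      exact div_nonneg (mul_nonneg h1 h2.le) h5.le
    rw [Finset.sum_eq_zero_iff_of_nonneg hterm] at hsum'
    have hr0 : r = 0 := by
      refine eq_zero_of_degree_lt_of_eval_finset_eq_zero T ?_ fun y hy => ?_
      · rw [hrd]
        exact_mod_cast (show W.card < T.card by omega)
      · have h1 := hsum' y hy
        have h2 := hR y hy
        have h4 : ∏ s ∈ T.erase y, (y - s) ≠ 0 := fun h => by simp [h] at h2
        have hc : c ≠ 0 := fun h => by simp [h] at h2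
        have hη0 : η ≠ 0 := by rcases hη with rfl | rfl <;> norm_num
        simpa [hη0, hc, h4] using h1
    rw [hr0, degree_zero] at hrd
    exact absurd hrd (by simp)

lemma integrable_eval {μ : Measure ℝ} (hμ : ∀ k : ℕ, Integrable (fun x : ℝ => x ^ k) μ)
    (p : ℝ[X]) : Integrable (fun x => p.eval x) μ := by
  simp only [eval_eq_sum_range]
  exact integrable_finsetSum _ fun i _ => (hμ i).const_mul _

/-- Positivity of Gaussian quadrature weights: the polynomial `∏ (x - t)` over `T` is orthogonal to
the polynomials of degree less than `|T|` with respect to the measure `dμ / ∏ (x - s)` of constant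
sign. -/
lemma integral_prod_erase_mul_pos {μ : Measure ℝ} (hμ : μ.support.Infinite)
    (hmom : ∀ k : ℕ, Integrable (fun x : ℝ => x ^ k) μ) {S T : Finset ℝ} (hST : S.card ≤ T.card)
    {η : ℝ} (hη : ∀ᵐ x ∂μ, 0 < η * ∏ s ∈ S, (x - s))
    (ho : ∀ r : ℝ[X], r.degree < T.card →
      Integrable (fun x => (∏ t ∈ T, (x - t)) * r.eval x * (∏ s ∈ S, (x - s))⁻¹) μ ∧
      ∫ x, (∏ t ∈ T, (x - t)) * r.eval x * (∏ s ∈ S, (x - s))⁻¹ ∂μ = 0)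
    {y : ℝ} (hy : y ∈ T) (hηy : 0 < η * ∏ s ∈ S, (y - s)) :
    0 < (∫ x, ∏ t ∈ T.erase y, (x - t) ∂μ) * ∏ t ∈ T.erase y, (y - t) := by
  set l : ℝ[X] := ∏ t ∈ T.erase y, (X - C t) with hl
  set Q : ℝ[X] := ∏ s ∈ S, (X - C s) with hQ
  have hle : ∀ x, ∏ t ∈ T.erase y, (x - t) = l.eval x := fun x => by simp [hl, eval_prod]
  have hQe : ∀ x, ∏ s ∈ S, (x - s) = Q.eval x := fun x => by simp [hQ, eval_prod]
  have hPe : ∀ x, ∏ t ∈ T, (x - t) = (x - y) * l.eval x := fun x => by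
    rw [← hle, Finset.mul_prod_erase T (fun t => x - t) hy]
  simp only [hle, hQe, hPe] at hη ho hηy ⊢
  have hly : l.eval y ≠ 0 := by
    rw [← hle]
    exact Finset.prod_ne_zero_iff.2 fun t ht => sub_ne_zero.2 (Finset.ne_of_mem_erase ht).symm
  -- This κ makes Q − κ l vanish at y. The quotient g by X − y then has degree below |T|, and
  -- testing orthogonality against g gives ∫ l dμ = κ ∫ l²/Q dμ.
  set κ := Q.eval y / l.eval y with hκ
  obtain ⟨g, hg⟩ : (X - C y) ∣ Q - C κ * l := by
    rw [dvd_iff_isRoot, IsRoot.def, eval_sub, eval_mul, eval_C, hκ]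
    field_simp
    ring
  have hge : ∀ x, (x - y) * g.eval x = Q.eval x - κ * l.eval x := fun x => by
    have := congrArg (eval x) hg
    simp only [eval_sub, eval_mul, eval_C, eval_X] at this
    linarith
  have hgd : g.degree < T.card := by
    have h1 : Q.natDegree ≤ T.card := by
      rw [hQ, natDegree_prod_of_monic _ _ fun s _ => monic_X_sub_C s]
      simpa using hST
    have h2 : l.natDegree ≤ T.card := by
      rw [hl, natDegree_prod_of_monic _ _ fun s _ => monic_X_sub_C s]
      simpa using (Finset.card_erase_lt_of_mem hy).le
    have h3 : (Q - C κ * l).natDegree ≤ T.card :=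
      (natDegree_sub_le _ _).trans (max_le h1 ((natDegree_C_mul_le _ _).trans h2))
    rcases eq_or_ne g 0 with h0 | h0
    · rw [h0, degree_zero]
      exact WithBot.bot_lt_coe _
    · rw [hg, natDegree_mul (X_sub_C_ne_zero y) h0, natDegree_X_sub_C] at h3
      rw [degree_eq_natDegree h0]
      exact_mod_cast (by omega : g.natDegree < T.card)
  obtain ⟨hint, hzero⟩ := ho g hgd
  have hlint := integrable_eval hmom l
  have hQne : ∀ᵐ x ∂μ, Q.eval x ≠ 0 := by
    filter_upwards [hη] with x hx h0
    simp [h0] at hx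
  have hae : ∀ᵐ x ∂μ, l.eval x - (x - y) * l.eval x * g.eval x * (Q.eval x)⁻¹ =
      κ * (l.eval x ^ 2 * (Q.eval x)⁻¹) := by
    filter_upwards [hQne] with x hx
    have h1 : (x - y) * l.eval x * g.eval x = l.eval x * (Q.eval x - κ * l.eval x) := by
      rw [← hge]
      ring
    rw [h1]
    field_simp
    ring
  have hκ0 : κ ≠ 0 := div_ne_zero (fun h => by simp [h] at hηy) hly
  -- Integrability of l²/Q is not given; it follows from the almost everywhere identity because κ ≠
  -- 0.
  have hint2 : Integrable (fun x => l.eval x ^ 2 * (Q.eval x)⁻¹) μ := by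
    refine (((hlint.sub hint).congr hae).const_mul κ⁻¹).congr (Eventually.of_forall fun x => ?_)
    simp only
    rw [inv_mul_cancel_left₀ hκ0]
  have heq : ∫ x, l.eval x ∂μ = κ * ∫ x, l.eval x ^ 2 * (Q.eval x)⁻¹ ∂μ := by
    rw [← integral_const_mul, ← integral_congr_ae hae, integral_sub hlint hint, hzero, sub_zero]
  have hη0 : η ≠ 0 := fun h => by simp [h] at hηy
  have hpos : ∀ᵐ x ∂μ, 0 ≤ η⁻¹ * (l.eval x ^ 2 * (Q.eval x)⁻¹) := by
    filter_upwards [hη] with x hx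
    have h1 : η⁻¹ * (l.eval x ^ 2 * (Q.eval x)⁻¹) = l.eval x ^ 2 * (η * Q.eval x)⁻¹ := by
      rw [mul_inv]
      ring
    rw [h1]
    positivity
  have hI : 0 < ∫ x, η⁻¹ * (l.eval x ^ 2 * (Q.eval x)⁻¹) ∂μ := by
    refine lt_of_le_of_ne (integral_nonneg_of_ae hpos) fun h0 => ?_
    have h1 := (integral_eq_zero_iff_of_nonneg_ae hpos (hint2.const_mul _)).1 h0.symm
    refine infinite_nonzero_of_support isOpen_univ (by simpa using hμ)
      l.continuous.continuousOn ?_ (g := fun x => l.eval x) ?_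
    · have hl0 : l ≠ 0 := fun h => by simp [h] at hly
      refine l.roots.toFinset.finite_toSet.subset fun x hx => ?_
      simp [hl0, hx.2]
    · filter_upwards [h1, hQne] with x hx hxQ
      simpa [hη0, hxQ] using hx
  rw [integral_const_mul] at hI
  rw [heq, hκ]
  calc 0 < (η * Q.eval y) * (η⁻¹ * ∫ x, l.eval x ^ 2 * (Q.eval x)⁻¹ ∂μ) := mul_pos hηy hI
    _ = _ := by field_simp

/-! ### Existence, uniqueness, degrees and location of zeros -/

section System

variable {m : ℕ} {σ : ℕ → SignedMeasure ℝ}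

lemma levelForm_add (m : ℕ) (σ : ℕ → SignedMeasure ℝ) (a b : ℕ → ℂ[X]) (j : ℕ) (z : ℂ) :
    levelForm m σ (fun i => a i + b i) j z = levelForm m σ a j z + levelForm m σ b j z := by
  simp only [levelForm, eval_add, mul_add, add_mul, Finset.sum_add_distrib]
  ring

lemma levelForm_C_mul (m : ℕ) (σ : ℕ → SignedMeasure ℝ) (c : ℂ) (a : ℕ → ℂ[X]) (j : ℕ) (z : ℂ) :
    levelForm m σ (fun i => C c * a i) j z = c * levelForm m σ a j z := by
  simp only [levelForm, eval_mul, eval_C, mul_add, Finset.mul_sum]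
  congr 1
  · ring
  · exact Finset.sum_congr rfl fun k _ => by ring

lemma IsNikishin.integral_levelDensity_add (h : IsNikishin m σ) (hm : 1 ≤ m) (a b : ℕ → ℂ[X])
    (ν : ℕ) : ∫ x : ℝ, (x : ℂ) ^ ν * levelDensity m σ (fun i => a i + b i) 1 x ∂(σ 1).variation =
      ∫ x : ℝ, (x : ℂ) ^ ν * levelDensity m σ a 1 x ∂(σ 1).variation +
      ∫ x : ℝ, (x : ℂ) ^ ν * levelDensity m σ b 1 x ∂(σ 1).variation := by
  rw [← integral_add (h.hasMoments_levelDensity hm a ν) (h.hasMoments_levelDensity hm b ν)]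
  simp only [levelDensity, levelForm_add, mul_add, zero_add]

lemma integral_levelDensity_C_mul (m : ℕ) (σ : ℕ → SignedMeasure ℝ) (c : ℂ) (a : ℕ → ℂ[X])
    (ν : ℕ) : ∫ x : ℝ, (x : ℂ) ^ ν * levelDensity m σ (fun i => C c * a i) 1 x ∂(σ 1).variation =
      c * ∫ x : ℝ, (x : ℂ) ^ ν * levelDensity m σ a 1 x ∂(σ 1).variation := by
  rw [← integral_const_mul]
  congr 1
  ext x
  rw [levelDensity, levelDensity, levelForm_C_mul]
  ring

/-- In this form a solution is determined by its last entry, linearly. -/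
lemma IsNikishin.isSolution_iff (h : IsNikishin m σ) {n : ℕ} {a : ℕ → ℂ[X]} :
    IsSolution m σ n a ↔ (∀ j < m, a j = polyPart (mom σ m (j + 1)) (a m)) ∧
      ∀ ν < n, ∫ x : ℝ, (x : ℂ) ^ ν * levelDensity m σ a 1 x ∂(σ 1).variation = 0 := by
  have := h.levelPoly_iff_reversed 0 a
  simp only [Nat.zero_le, true_implies] at this
  exact ⟨fun ha => ⟨this.1 ha.poly, ha.orth⟩, fun ha => ⟨this.2 ha.1, ha.2⟩⟩

lemma IsSolution.add (h : IsNikishin m σ) (hm : 1 ≤ m) {n : ℕ} {a b : ℕ → ℂ[X]}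
    (ha : IsSolution m σ n a) (hb : IsSolution m σ n b) :
    IsSolution m σ n fun i => a i + b i := by
  rw [h.isSolution_iff] at ha hb ⊢
  refine ⟨fun j hj => ?_, fun ν hν => ?_⟩
  · rw [map_add, ← ha.1 j hj, ← hb.1 j hj]
  · rw [h.integral_levelDensity_add hm, ha.2 ν hν, hb.2 ν hν, add_zero]

lemma IsSolution.C_mul (h : IsNikishin m σ) {n : ℕ} {a : ℕ → ℂ[X]}
    (ha : IsSolution m σ n a) (c : ℂ) : IsSolution m σ n fun i => C c * a i := by
  rw [h.isSolution_iff] at ha ⊢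
  refine ⟨fun j hj => ?_, fun ν hν => ?_⟩
  · simp only [← smul_eq_C_mul]
    rw [map_smul, ← ha.1 j hj]
  · rw [integral_levelDensity_C_mul, ha.2 ν hν, mul_zero]

/-- The real part of a_m has n zeros but degree below n, so it vanishes; the solution i·a takes care
of the imaginary part. -/
lemma IsSolution.last_eq_zero (h : IsNikishin m σ) (hm : 1 ≤ m) {n : ℕ} {a : ℕ → ℂ[X]}
    (ha : IsSolution m σ n a) (hd : (a m).degree < n) : a m = 0 := by
  have hre : ∀ b : ℕ → ℂ[X], IsSolution m σ n b → (∀ i, n ≤ i → (b m).coeff i = 0) →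
      ∀ i, ((b m).coeff i).re = 0 := by
    intro b hb hbd
    obtain ⟨S, hS, -, h0⟩ := hb.exists_zeros h hm
    exact re_coeff_eq_zero (fun i hi => by rw [hbd i (hS ▸ hi), Complex.zero_re]) h0
  rw [degree_lt_iff_coeff_zero] at hd
  ext i
  refine Complex.ext (hre a ha hd i) ?_
  have := hre _ (ha.C_mul h Complex.I) (fun i hi => by rw [coeff_C_mul, hd i hi, mul_zero]) i
  simpa using this

lemma IsSolution.eq_zero (h : IsNikishin m σ) {n : ℕ} {a : ℕ → ℂ[X]}
    (ha : IsSolution m σ n a) (h0 : a m = 0) {j : ℕ} (hj : j ≤ m) : a j = 0 := by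
  rcases hj.eq_or_lt with rfl | hj
  · exact h0
  · rw [(h.isSolution_iff.1 ha).1 j hj, h0, map_zero]

lemma IsSolution.degree_last (h : IsNikishin m σ) (hm : 1 ≤ m) {n : ℕ} {a : ℕ → ℂ[X]}
    (ha : IsSolution m σ n a) (hA : IsAdmissible m n a) : (a m).degree = n := by
  refine le_antisymm hA.degree_le (not_lt.1 fun hlt => ?_)
  obtain ⟨j, hj, hne⟩ := hA.nonzero
  exact hne (ha.eq_zero h (ha.last_eq_zero h hm hlt) hj)

/-- The density has constant sign almost everywhere for a nonzero measure. -/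
lemma IsNikishin.mom_zero_ne_zero (h : IsNikishin m σ) {j k : ℕ} (h1 : 1 ≤ j) (h2 : j ≤ m)
    (h3 : 1 ≤ k) (h4 : k ≤ m) : mom σ j k 0 ≠ 0 := by
  have hd := h.hasNiceDensity h1 h2 h3 h4
  obtain ⟨η, hη, hpos⟩ := hd.sign
  have he : mom σ j k 0 = ((∫ x, dens σ j k x ∂(σ j).variation : ℝ) : ℂ) := by
    rw [mom, ← integral_complex_ofReal]
    simp
  rw [he, Complex.ofReal_ne_zero]
  intro h0
  have h5 : ∫ x, η * dens σ j k x ∂(σ j).variation = 0 := by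
    rw [integral_const_mul, h0, mul_zero]
  rw [integral_eq_zero_iff_of_nonneg_ae (hpos.mono fun x hx => hx.le)
    (hd.integrable.const_mul _)] at h5
  have h6 : ∀ᵐ x ∂(σ j).variation, False := by
    filter_upwards [hpos, h5] with x hx hx'
    exact hx.ne' hx'
  rw [eventually_false_iff_eq_bot, ae_eq_bot] at h6
  exact h.variation_ne_zero h1 h2 h6

lemma IsSolution.degree_eq (h : IsNikishin m σ) {n : ℕ} {a : ℕ → ℂ[X]}
    (ha : IsSolution m σ n a) (hn : 1 ≤ n) (hd : (a m).degree = n) {j : ℕ} (hj : j < m) :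
    (a j).degree = ((n - 1 : ℕ) : WithBot ℕ) := by
  obtain ⟨n, rfl⟩ : ∃ k, n = k + 1 := ⟨n - 1, by omega⟩
  rw [(h.isSolution_iff.1 ha).1 j hj, Nat.add_sub_cancel]
  have h1 := degree_polyPart_lt (mom σ m (j + 1)) hd.le
  refine le_antisymm ?_ (le_degree_of_ne_zero ?_)
  · rw [degree_lt_iff_coeff_zero] at h1
    rw [degree_le_iff_coeff_zero]
    intro i hi
    have : n < i := by exact_mod_cast hi
    exact h1 i this
  -- The top coefficient of a_j is that of a_m times the total mass of s_{m,j+1}.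
  · rw [coeff_polyPart _ hd.le]
    refine mul_ne_zero ?_ (h.mom_zero_ne_zero (by omega) le_rfl (by omega) hj)
    exact coeff_ne_zero_of_eq_degree hd

lemma IsSolution.exists_eq_C_mul (h : IsNikishin m σ) (hm : 1 ≤ m) {n : ℕ} {a b : ℕ → ℂ[X]}
    (ha : IsSolution m σ n a) (hb : IsSolution m σ n b) (hda : (a m).degree = n)
    (hdb : (b m).degree = n) : ∃ c : ℂ, c ≠ 0 ∧ ∀ j ≤ m, b j = C c * a j := by
  have hca : (a m).coeff n ≠ 0 := coeff_ne_zero_of_eq_degree hda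
  have hcb : (b m).coeff n ≠ 0 := coeff_ne_zero_of_eq_degree hdb
  refine ⟨(b m).coeff n / (a m).coeff n, div_ne_zero hcb hca, ?_⟩
  set c := (b m).coeff n / (a m).coeff n with hc
  -- The factor c matches the coefficients of degree n, so b − c·a is a solution whose last entry
  -- has degree below n, hence zero.
  have hs := hb.add h hm (ha.C_mul h (-c))
  have hlt : (b m + C (-c) * a m).degree < n := by
    rw [degree_lt_iff_coeff_zero]
    intro i hi
    rw [coeff_add, coeff_C_mul]
    rcases hi.eq_or_lt with rfl | hi
    · rw [hc]
      field_simp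
      ring
    · rw [coeff_eq_zero_of_degree_lt (by rw [hdb]; exact_mod_cast hi),
        coeff_eq_zero_of_degree_lt (by rw [hda]; exact_mod_cast hi), mul_zero, add_zero]
  intro j hj
  have := hs.eq_zero h (hs.last_eq_zero h hm hlt) hj
  simp only [C_neg, neg_mul] at this
  linear_combination this

/-- The vector determined by its last entry `P` and the vanishing of the polynomial parts of the
reversed forms. -/
def reconstruct (m : ℕ) (σ : ℕ → SignedMeasure ℝ) (P : ℂ[X]) (j : ℕ) : ℂ[X] :=
  if j = m then P else polyPart (mom σ m (j + 1)) P

lemma reconstruct_add (m : ℕ) (σ : ℕ → SignedMeasure ℝ) (P Q : ℂ[X]) :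
    reconstruct m σ (P + Q) = fun j => reconstruct m σ P j + reconstruct m σ Q j := by
  ext1 j
  by_cases hj : j = m <;> simp [reconstruct, hj]

lemma reconstruct_smul (m : ℕ) (σ : ℕ → SignedMeasure ℝ) (c : ℂ) (P : ℂ[X]) :
    reconstruct m σ (c • P) = fun j => C c * reconstruct m σ P j := by
  ext1 j
  by_cases hj : j = m <;> simp [reconstruct, hj, ← smul_eq_C_mul]

/-- The first `n` moments of `𝓐_1 dσ_1`, as a function of the last entry of the vector. -/
def IsNikishin.momentMap (h : IsNikishin m σ) (hm : 1 ≤ m) (n : ℕ) : ℂ[X] →ₗ[ℂ] (Fin n → ℂ) where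
  toFun P ν := ∫ x : ℝ, (x : ℂ) ^ (ν : ℕ) * levelDensity m σ (reconstruct m σ P) 1 x
    ∂(σ 1).variation
  map_add' P Q := by
    ext ν
    rw [reconstruct_add, h.integral_levelDensity_add hm]
    rfl
  map_smul' c P := by
    ext ν
    rw [reconstruct_smul, integral_levelDensity_C_mul]
    rfl

/-- The n moment conditions on the (n + 1)-dimensional space of last entries have a nontrivial
kernel. -/
lemma IsNikishin.exists_isSolution (h : IsNikishin m σ) (hm : 1 ≤ m) (n : ℕ) :
    ∃ a, IsAdmissible m n a ∧ IsSolution m σ n a := by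
  have hfr : Module.finrank ℂ (Fin n → ℂ) < Module.finrank ℂ (degreeLT ℂ (n + 1)) := by
    rw [(degreeLTEquiv ℂ (n + 1)).finrank_eq]
    simp
  have : FiniteDimensional ℂ (degreeLT ℂ (n + 1)) :=
    Module.Finite.equiv (degreeLTEquiv ℂ (n + 1)).symm
  have hker := LinearMap.ker_ne_bot_of_finrank_lt
    (f := (h.momentMap hm n).comp (degreeLT ℂ (n + 1)).subtype) hfr
  obtain ⟨⟨P, hPd⟩, hP, hP0⟩ := (Submodule.ne_bot_iff _).1 hker
  have hP0 : P ≠ 0 := fun h0 => hP0 (Subtype.ext h0)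
  have hPd : P.degree ≤ n := by
    rw [mem_degreeLT, degree_lt_iff_coeff_zero] at hPd
    rw [degree_le_iff_coeff_zero]
    intro i hi
    have : n < i := by exact_mod_cast hi
    exact hPd i this
  have hPm : reconstruct m σ P m = P := if_pos rfl
  refine ⟨reconstruct m σ P, ⟨⟨m, le_rfl, by rwa [hPm]⟩, fun j hj => ?_, by rwa [hPm]⟩, ?_⟩
  · rw [reconstruct, if_neg hj.ne]
    exact degree_polyPart_lt _ hPd
  · rw [h.isSolution_iff, hPm]
    refine ⟨fun j hj => if_neg hj.ne, fun ν hν => ?_⟩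
    exact congrFun (LinearMap.mem_ker.1 hP) ⟨ν, hν⟩

lemma ZerosSimpleInInterior.of_C_mul {c : ℂ} (hc : c ≠ 0) {p : ℂ[X]} {Δ : Set ℝ}
    (h : ZerosSimpleInInterior (C c * p) Δ) : ZerosSimpleInInterior p Δ := by
  rcases eq_or_ne p 0 with rfl | hp
  · simpa using h
  intro z hz
  have h1 := h z (by rw [IsRoot.def, eval_mul, hz.eq_zero, mul_zero])
  rw [rootMultiplicity_mul (mul_ne_zero (C_ne_zero.2 hc) hp), rootMultiplicity_C, zero_add] at h1
  exact h1

lemma IsSolution.exists_last_eq_prod (h : IsNikishin m σ) (hm : 1 ≤ m) {n : ℕ} {a : ℕ → ℂ[X]}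
    (ha : IsSolution m σ n a) (hmon : (a m).Monic) (hd : (a m).natDegree = n) :
    ∃ T : Finset ℝ, T.card = n ∧ (∀ t ∈ T, t ∈ interior (hull σ m)) ∧
      a m = (∏ t ∈ T, (X - C t) : ℝ[X]).map Complex.ofRealHom := by
  -- Multiplying by −i turns imaginary parts into real parts. As a_m is monic, its imaginary part
  -- has degree below n, yet n zeros: hence a_m is real.
  obtain ⟨S, hS, -, h0⟩ := (ha.C_mul h (-Complex.I)).exists_zeros h hm
  have him : ∀ i, ((a m).coeff i).im = 0 := by
    intro i
    have := re_coeff_eq_zero (fun i hi => by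
      rw [hS] at hi
      rcases hi.eq_or_lt with rfl | hi
      · rw [coeff_C_mul, ← hd, hmon.coeff_natDegree]
        simp
      · rw [coeff_C_mul, coeff_eq_zero_of_natDegree_lt (by omega)]
        simp) h0 i
    simpa using this
  obtain ⟨T, hT, hTi, hT0⟩ := ha.exists_zeros h hm
  have hmap := map_rePoly him
  have hP : rePoly (a m) = ∏ t ∈ T, (X - C t) := by
    refine eq_prod_of_monic ?_ ?_ fun t ht => by rw [eval_rePoly, hT0 t ht]
    · rwa [← hmap, monic_map_iff] at hmon
    · rw [← hmap, natDegree_map] at hd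
      rw [hd, hT]
  exact ⟨T, hT, hTi, by rw [← hP, hmap]⟩

/-- The real moments of `σ_m` give a real polynomial with the values of `a_{m-1}`. -/
lemma IsNikishin.eval_polyPart_prod (h : IsNikishin m σ) (hm : 1 ≤ m) {T : Finset ℝ} {y : ℝ}
    (hy : y ∈ T) :
    (polyPart (fun i => ∫ x, x ^ i * dens σ m m x ∂(σ m).variation)
      (∏ t ∈ T, (X - C t))).eval y =
      sgn (σ m) * ∫ x, ∏ t ∈ T.erase y, (x - t) ∂(σ m).variation := by
  rw [← Finset.mul_prod_erase T _ hy, eval_polyPart_X_sub_C_mul, momentFunctional, lsum_apply,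
    Polynomial.sum]
  have hd : ∀ x, dens σ m m x = sgn (σ m) := fun x => by simp [dens]
  set l : ℝ[X] := ∏ t ∈ T.erase y, (X - C t) with hl
  have hle : ∀ x, ∏ t ∈ T.erase y, (x - t) = l.eval x := fun x => by simp [hl, eval_prod]
  simp only [hle, hd, eval_eq_sum, Polynomial.sum]
  rw [integral_finsetSum _ fun i _ => (h.moments hm le_rfl i).const_mul _, Finset.mul_sum]
  refine Finset.sum_congr rfl fun i _ => ?_
  rw [LinearMap.toSpanSingleton_apply, integral_mul_const, integral_const_mul, smul_eq_mul]
  ring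

/-- At each t ∈ T the value of a_{m−1} is ∫ a_m(x)/(x − t) dσ_m(x), and the positivity lemma gives
it the sign of a_m'(t) up to the sign of σ_m. These signs alternate along T, so a_{m−1} has n − 1
zeros among the points of the interior of Δ_m. -/
lemma IsSolution.exists_penultimate_zeros (h : IsNikishin m σ) (hm : 1 ≤ m) {n : ℕ}
    {a : ℕ → ℂ[X]} (ha : IsSolution m σ n a) {T : Finset ℝ} (hn : 1 ≤ n) (hT : T.card = n)
    (hTi : ∀ t ∈ T, t ∈ interior (hull σ m))
    (hP : a m = (∏ t ∈ T, (X - C t) : ℝ[X]).map Complex.ofRealHom) :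
    ∃ Z : Finset ℝ, Z.card = n - 1 ∧ (∀ z ∈ Z, z ∈ interior (hull σ m)) ∧
      ∀ z ∈ Z, (a (m - 1)).eval (z : ℂ) = 0 := by
  set R : ℝ[X] := polyPart (fun i => ∫ x, x ^ i * dens σ m m x ∂(σ m).variation)
    (∏ t ∈ T, (X - C t)) with hR
  have hRm : a (m - 1) = R.map Complex.ofRealHom := by
    rw [(h.isSolution_iff.1 ha).1 (m - 1) (by omega), hP, hR, map_polyPart,
      Nat.sub_add_cancel hm]
    congr 2
    ext1 i
    rw [mom, Complex.ofRealHom_eq_coe, ← integral_complex_ofReal]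
    simp
  obtain ⟨S, hS⟩ := ha.exists_isOrthogonal h hm le_rfl
  obtain ⟨η, hη, hη1, hη2⟩ := hS.sign
  have hform : ∀ x : ℝ, (levelForm m σ a m x).re = (-1) ^ m * ∏ t ∈ T, (x - t) := by
    intro x
    rw [levelForm_last, show (-1 : ℂ) ^ m = (((-1 : ℝ) ^ m : ℝ) : ℂ) by push_cast; rfl,
      Complex.re_ofReal_mul, hP, eval_map_ofReal, Complex.ofReal_re, eval_prod]
    simp
  have hsq : ((-1 : ℝ) ^ m) * (-1) ^ m = 1 := by
    rw [← mul_pow]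
    simp
  have horth : ∀ r : ℝ[X], r.degree < T.card →
      Integrable (fun x => (∏ t ∈ T, (x - t)) * r.eval x * (∏ s ∈ S, (x - s))⁻¹)
        (σ m).variation ∧
      ∫ x, (∏ t ∈ T, (x - t)) * r.eval x * (∏ s ∈ S, (x - s))⁻¹ ∂(σ m).variation = 0 := by
    intro r hr
    obtain ⟨h1, h2⟩ := hS.orth r (hT ▸ hr)
    have e : ∀ x, (∏ t ∈ T, (x - t)) * r.eval x * (∏ s ∈ S, (x - s))⁻¹ =
        (-1) ^ m * ((levelForm m σ a m x).re * r.eval x * (∏ s ∈ S, (x - s))⁻¹) := by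
      intro x
      rw [hform]
      linear_combination (-((∏ t ∈ T, (x - t)) * r.eval x * (∏ s ∈ S, (x - s))⁻¹)) * hsq
    simp only [e]
    refine ⟨h1.const_mul _, ?_⟩
    rw [integral_const_mul, h2, mul_zero]
  obtain ⟨Z, hZ, hZi, hZ0⟩ := exists_zeros_of_interlacing
    (convex_convexHull ℝ (supp (σ m))).interior.ordConnected
    (Finset.card_pos.1 (by omega)) hTi (R := R) (c := sgn (σ m)) (by
      intro y hy
      have h1 := integral_prod_erase_mul_pos (h.mem m hm le_rfl).infinite_supp
        (h.moments hm le_rfl) (hS.card.trans hT.ge) hη1 horth hy (hη2 y (hTi y hy))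
      rw [hR, h.eval_polyPart_prod hm hy]
      calc 0 < _ := h1
        _ = _ := by linear_combination (-((∫ x, ∏ t ∈ T.erase y, (x - t) ∂(σ m).variation) *
            ∏ t ∈ T.erase y, (y - t))) * h.sgn_mul_self hm le_rfl)
  refine ⟨Z, hZ.trans (by rw [hT]), hZi, fun z hz => ?_⟩
  rw [hRm, eval_map_ofReal, hZ0 z hz, Complex.ofReal_zero]

lemma IsSolution.zerosSimpleInInterior (h : IsNikishin m σ) (hm : 1 ≤ m) {n : ℕ} (hn : 1 ≤ n)
    {a : ℕ → ℂ[X]} (ha : IsSolution m σ n a) (hd : (a m).degree = n) :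
    ZerosSimpleInInterior (a (m - 1)) (hull σ m) ∧ ZerosSimpleInInterior (a m) (hull σ m) := by
  have hlc : (a m).leadingCoeff ≠ 0 := by
    rw [leadingCoeff_ne_zero]
    rintro h0
    simp [h0] at hd
  have hinv := inv_ne_zero hlc
  have hb := ha.C_mul h (a m).leadingCoeff⁻¹
  have hmon : (C (a m).leadingCoeff⁻¹ * a m).Monic := by
    rw [Monic, leadingCoeff_mul, leadingCoeff_C, inv_mul_cancel₀ hlc]
  have hbd : (C (a m).leadingCoeff⁻¹ * a m).degree = n := by rw [degree_C_mul hinv, hd]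
  have hbn := natDegree_eq_of_degree_eq_some hbd
  obtain ⟨T, hT, hTi, hP⟩ := hb.exists_last_eq_prod h hm hmon hbn
  obtain ⟨Z, hZ, hZi, hZ0⟩ := hb.exists_penultimate_zeros h hm hn hT hTi hP
  have hpd := hb.degree_eq h hn hbd (show m - 1 < m by omega)
  constructor
  · refine ZerosSimpleInInterior.of_C_mul hinv
      (zerosSimpleInInterior_of_eval_eq_zero ?_ ?_ hZi hZ0)
    · rintro h0
      simp [h0] at hpd
    · rw [hZ, natDegree_eq_of_degree_eq_some hpd]
  · refine ZerosSimpleInInterior.of_C_mul hinv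
      (zerosSimpleInInterior_of_eval_eq_zero hmon.ne_zero ?_ hTi fun t ht => ?_)
    · rw [hT, hbn]
    · rw [hP, eval_map_ofReal, eval_prod, Finset.prod_eq_zero ht (by simp), Complex.ofReal_zero]

end System

end Nikishin

end

theorem theorem1 (m : ℕ) (hm : 2 ≤ m) (σ : ℕ → MeasureTheory.SignedMeasure ℝ)
    (hσ : Nikishin.IsNikishin m σ) (n : ℕ) (hn : 1 ≤ n) :
    (∀ a : ℕ → Polynomial ℂ, Nikishin.IsDR m σ n a ↔ Nikishin.IsML m σ n a) ∧
    (∃ a : ℕ → Polynomial ℂ, Nikishin.IsML m σ n a) ∧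
    (∀ a b : ℕ → Polynomial ℂ, Nikishin.IsML m σ n a → Nikishin.IsML m σ n b →
      ∃ c : ℂ, c ≠ 0 ∧ ∀ j ≤ m, b j = Polynomial.C c * a j) ∧
    (∀ a : ℕ → Polynomial ℂ, Nikishin.IsML m σ n a →
      (∀ j < m, (a j).degree = ((n - 1 : ℕ) : WithBot ℕ)) ∧
      (a m).degree = (n : WithBot ℕ) ∧
      Nikishin.ZerosSimpleInInterior (a (m - 1)) (Nikishin.hull σ m) ∧
      Nikishin.ZerosSimpleInInterior (a m) (Nikishin.hull σ m)) := by
  have hm1 : 1 ≤ m := by omega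
  refine ⟨hσ.isDR_iff_isML n, ?_, fun a b ha hb => ?_, fun a ha => ?_⟩
  · obtain ⟨a, ha⟩ := hσ.exists_isSolution hm1 n
    exact ⟨a, (hσ.isML_iff hm1 n a).2 ha⟩
  · obtain ⟨hA, ha⟩ := (hσ.isML_iff hm1 n a).1 ha
    obtain ⟨hB, hb⟩ := (hσ.isML_iff hm1 n b).1 hb
    exact ha.exists_eq_C_mul hσ hm1 hb (ha.degree_last hσ hm1 hA) (hb.degree_last hσ hm1 hB)
  · obtain ⟨hA, ha⟩ := (hσ.isML_iff hm1 n a).1 ha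
    have hd := ha.degree_last hσ hm1 hA
    exact ⟨fun j hj => ha.degree_eq hσ hn hd hj, hd, ha.zerosSimpleInInterior hσ hm1 hn hd⟩
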